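/- All manifolds are topological, compact, connected and oriented, and all embeddings are locally flat. Let $X$ be a simply connected $4$-manifold with an identification $\partial X = S^3$, and let $K$ be a knot in $S^3$ (a locally flat embedded circle). For a subset $F \subset X$ write $DX = X\cup_{\partial X} X$ for the double of $X$ and $DF \subset DX$ for the double of $F$, the union of the two copies of $F$. The $X$-superslice genus of $K$ is \[ g_s^X(K)=\min\{\operatorname{genus}(F)\mid \pi_1(DX\smallsetminus DF)\cong\mathbb{Z}\}\in\{0,1,2,\dots\}\cup\{\infty\}, \] where $F$ runs over all properly embedded surfaces in $X$ with $\partial F=F\cap \partial X=K$ (so $F$ is a compact connected orientable surface with one boundary circle), and the minimum over the empty set is $\infty$. Then, for every knot $K$ in $S^3$ and every simply connected $4$-manifold $X$ with boundary $S^3$, \[ g_s^X(K)\le g_s^{D^4}(K). \] -/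

import Mathlib

open Set

noncomputable section

namespace Superslice

/-- The `3`-sphere, the unit sphere of `ℝ⁴`. -/
abbrev S3 : Type := Metric.sphere (0 : EuclideanSpace ℝ (Fin 4)) 1

/-- The closed unit ball of `ℝ⁴`. -/
abbrev D4 : Type := Metric.closedBall (0 : EuclideanSpace ℝ (Fin 4)) 1

/-- The inclusion of `S³` as the boundary of `D⁴`. -/
def sphereToBall : S3 → D4 := fun s => ⟨s.1, Metric.sphere_subset_closedBall s.2⟩

/-- A knot in `S³`: a locally flat subset homeomorphic to the circle. -/
structure IsKnot (K : Set S3) : Prop where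
  homeo_circle : Nonempty (Circle ≃ₜ K)
  locallyFlat : ∀ x ∈ K, ∃ e : OpenPartialHomeomorph S3 (EuclideanSpace ℝ (Fin 3)),
    x ∈ e.source ∧ ∀ y ∈ e.source, (y ∈ K ↔ e y 1 = 0 ∧ e y 2 = 0)

/-- `X` is a compact topological `4`-manifold whose boundary is identified with `S³` through
`b : S³ → X`. Every point lies in a chart with values in an open subset of the half-space
`{x ∈ ℝ⁴ | 0 ≤ x₀}` in which the boundary `b(S³)` corresponds to `x₀ = 0`. (Points off the
boundary therefore have Euclidean neighbourhoods.) -/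
structure IsFourManifoldBoundedBy (X : Type*) [TopologicalSpace X] (b : S3 → X) : Prop where
  t2 : T2Space X
  compact : CompactSpace X
  isEmbedding : Topology.IsEmbedding b
  chart : ∀ x : X, ∃ e : OpenPartialHomeomorph X (EuclideanHalfSpace 4),
    x ∈ e.source ∧ ∀ y ∈ e.source, (y ∈ range b ↔ (e y).1 0 = 0)

/-- The compact connected orientable surface of genus `g` with one boundary circle, in `ℝ³`.
The function `p(x, y)` on the right-hand side is nonnegative exactly on the closed disc of radius
`3g + 2` about the origin with `g` disjoint open unit discs, centred at `(-3i, 0)` for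
`1 ≤ i ≤ g`, removed. So `z² = p(x, y)` is the double of a disc with `g` holes, i.e. the closed
orientable surface of genus `g`; the condition `x ≤ 0` removes an open disc from it. -/
def modelSurface (g : ℕ) : Set (ℝ × ℝ × ℝ) :=
  {v | v.1 ≤ 0 ∧ v.2.2 ^ 2 = ((3 * (g : ℝ) + 2) ^ 2 - v.1 ^ 2 - v.2.1 ^ 2) *
    ∏ i ∈ Finset.Icc 1 g, ((v.1 + 3 * (i : ℝ)) ^ 2 + v.2.1 ^ 2 - 1)}

/-- The boundary circle of the model surface. -/
def modelBoundary (g : ℕ) : Set (modelSurface g) := {v | v.1.1 = 0}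

/-- `F` is a properly embedded, locally flat, compact connected orientable surface of genus `g`
in `X`, with `∂F = F ∩ ∂X = K`. Near each of its points, `(X, F)` is modelled on
`(ℝ⁴₊, ℝ²₊)`, where `ℝ²₊ = {x ∈ ℝ⁴₊ | x₂ = x₃ = 0}`, with `∂X` corresponding to `x₀ = 0`. -/
structure IsProperSurface {X : Type*} [TopologicalSpace X] (b : S3 → X) (K : Set S3)
    (g : ℕ) (F : Set X) : Prop where
  param : ∃ f : modelSurface g → X,
    Topology.IsEmbedding f ∧ range f = F ∧ f '' modelBoundary g = b '' K
  inter_boundary : F ∩ range b = b '' K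
  locallyFlat : ∀ x ∈ F, ∃ e : OpenPartialHomeomorph X (EuclideanHalfSpace 4),
    x ∈ e.source ∧ ∀ y ∈ e.source,
      (y ∈ range b ↔ (e y).1 0 = 0) ∧ (y ∈ F ↔ (e y).1 2 = 0 ∧ (e y).1 3 = 0)

/-- The gluing relation on two copies of `X`: the copies of each point of `A` are identified. -/
def doubleSetoid {X : Type*} (A : Set X) : Setoid (X × Bool) where
  r p q := p.1 = q.1 ∧ (p.2 = q.2 ∨ p.1 ∈ A)
  iseqv :=
    { refl := fun _ => ⟨rfl, Or.inl rfl⟩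
      symm := fun {p q} h => ⟨h.1.symm, h.2.imp Eq.symm fun hA => h.1 ▸ hA⟩
      trans := fun {p q r} h k => ⟨h.1.trans k.1, by
        rcases h.2 with h2 | h2
        · rcases k.2 with k2 | k2
          · exact Or.inl (h2.trans k2)
          · exact Or.inr (by rw [h.1]; exact k2)
        · exact Or.inr h2⟩ }

/-- The double of `X` along `A`, with the quotient topology; `D X` is the case `A = ∂X`. -/
def Double {X : Type*} (A : Set X) : Type _ := Quotient (doubleSetoid A)

instance {X : Type*} [TopologicalSpace X] (A : Set X) : TopologicalSpace (Double A) :=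
  inferInstanceAs (TopologicalSpace (Quotient (doubleSetoid A)))

/-- The double of a subset `F` of `X`, as a subset of the double of `X`. -/
def doubleSet {X : Type*} (A F : Set X) : Set (Double A) :=
  Quotient.mk (doubleSetoid A) '' {p | p.1 ∈ F}

/-- The condition `π₁(W ∖ S) ≅ ℤ`, which makes an embedded surface `S` in `W` a `ℤ`-surface
(the complement is path connected, and its fundamental group is infinite cyclic). -/
def IsZSurface {W : Type*} [TopologicalSpace W] (S : Set W) : Prop :=
  IsPathConnected Sᶜ ∧
    ∀ x : ↥(Sᶜ), Nonempty (FundamentalGroup ↥(Sᶜ) x ≃* Multiplicative ℤ)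

/-- The `X`-superslice genus of `K`: the least genus of a properly embedded surface `F` in `X`
with `∂F = K` whose double is a `ℤ`-surface in the double of `X` (`⊤` if there is none). -/
def supersliceGenus {X : Type*} [TopologicalSpace X] (b : S3 → X) (K : Set S3) : ℕ∞ :=
  ⨅ g ∈ {g : ℕ | ∃ F : Set X, IsProperSurface b K g F ∧
    IsZSurface (doubleSet (range b) F)}, (g : ℕ∞)

end Superslice

end

/-! Let `F` be a surface in `D⁴` whose double is a `ℤ`-surface. The complement of the double is
nonempty, so `F` misses some point, and, being closed, some point `p` of the open ball. Coning the
sphere to `p` identifies the ball minus `p` with the half-open collar `S³ × [0, 1)`, so `F` is the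
image of a compact subset `G` of the collar. By Brown's theorem the boundary of `X` also has an open
collar. Placing `G` there gives a surface `F'` in `X` with the same genus and boundary.

It remains to compare fundamental groups. Choose `δ < 1` bounding the heights of `G`. The complement
of the double of `F'` in `DX` is the doubled collar minus the double of `G`, together with two caps,
the copies of `X` minus the closed collar of height `δ`. Each cap is simply connected because `X`
is, and it meets the rest in `S³ × (δ, 1)`, which is simply connected because `S³` is. By van
Kampen, attaching the caps does not change `π₁`. The same holds for `D⁴`, and the doubled collar
does not remember which manifold it came from (`hasInfiniteCyclicPi1_compl_doubleSet_iff`).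

The required case of van Kampen is split in two: paths deform into the smaller piece
(`exists_path_homotopic_of_isSimplyConnected`), and homotopies between paths of that piece can be
taken inside it (`homotopic_of_homotopic_map_val`). -/

noncomputable section

/-! ### Van Kampen, surjectivity: deforming paths into an open set -/

namespace Superslice

open Topology unitInterval

/-- The path in the subtype `S` traced by a path with values in `S`. -/
def pathIn {Y : Type*} [TopologicalSpace Y] {S : Set Y} {a b : Y} (p : Path a b)
    (hp : ∀ t, p t ∈ S) :
    Path (⟨a, by simpa using hp 0⟩ : S) ⟨b, by simpa using hp 1⟩ where
  toFun t := ⟨p t, hp t⟩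
  source' := by simp
  target' := by simp

theorem homotopic_of_mem_isSimplyConnected {Y : Type*} [TopologicalSpace Y] {S : Set Y}
    (hS : IsSimplyConnected S) {a b : Y} (p q : Path a b) (hp : ∀ t, p t ∈ S)
    (hq : ∀ t, q t ∈ S) : p.Homotopic q := by
  have := hS.simplyConnectedSpace
  exact (SimplyConnectedSpace.paths_homotopic (pathIn p hp) (pathIn q hq)).map
    ⟨Subtype.val, continuous_subtype_val⟩

theorem isSimplyConnected_preimage_val {Y : Type*} [TopologicalSpace Y] {S T : Set Y}
    (h : IsSimplyConnected (S ∩ T)) : IsSimplyConnected ((↑) ⁻¹' T : Set S) := by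
  rw [← (IsEmbedding.subtypeVal (p := (· ∈ S))).isSimplyConnected_image]
  convert h using 1
  exact Subtype.image_preimage_coe S T

section Subdivision

variable {W : Type*} [TopologicalSpace W] {U V : Set W}

/-- A path whose ends lie in `U` can be deformed into `U`, if the pieces of it that
leave `U` do so through a simply connected set `V` that meets `U` in a path connected set. -/
theorem exists_path_homotopic_of_isSimplyConnected (hU : IsOpen U) (hV : IsOpen V)
    (hUV : U ∪ V = univ) (hVs : IsSimplyConnected V) (hI : IsPathConnected (U ∩ V))
    {a b : U} (γ : Path (a : W) b) :
    ∃ τ : Path a b, (τ.map continuous_subtype_val).Homotopic γ := by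
  obtain ⟨x₀, hx₀⟩ := hI.nonempty
  obtain ⟨t, t0, tm, ⟨n, hn⟩, ht⟩ := exists_monotone_Icc_subset_open_cover_unitInterval
    (c := fun i : Bool => γ ⁻¹' (bif i then U else V))
    (by rintro (_ | _); exacts [hV.preimage γ.continuous, hU.preimage γ.continuous])
    (by
      intro s _
      rcases (hUV ▸ mem_univ (γ s) : γ s ∈ U ∪ V) with h | h
      · exact mem_iUnion.2 ⟨true, h⟩
      · exact mem_iUnion.2 ⟨false, h⟩)
  have step : ∀ k s, (hs : s ∈ Icc (t k) (t (k + 1))) → ∀ r, (γ.subpath (t k) s) r ∈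
      γ '' Icc (t k) (t (k + 1)) := by
    intro k s hs r
    have : (γ.subpath (t k) s) r ∈ range (γ.subpath (t k) s) := mem_range_self r
    rw [γ.range_subpath_of_le _ _ hs.1] at this
    exact image_mono (Icc_subset_Icc_right hs.2) this
  -- Induction along the subdivision. The initial part of `γ` is kept either as a path in `U`, or as
  -- a path in `U` to `x₀` followed by a path in `V`. On `U ∩ V` the two forms are interchangeable:
  -- a path `ω` from `x₀` inside `U ∩ V` can be inserted and cancelled, or can replace the `V`-tail
  -- because `V` is simply connected.
  have key : ∀ k, (∀ h : γ (t k) ∈ U, ∃ τ : Path a ⟨γ (t k), h⟩,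
        (τ.map continuous_subtype_val).Homotopic ((γ.subpath 0 (t k)).cast γ.source.symm rfl)) ∧
      (γ (t k) ∈ V → ∃ τ : Path a ⟨x₀, hx₀.1⟩, ∃ β : Path x₀ (γ (t k)), (∀ r, β r ∈ V) ∧
        ((τ.map continuous_subtype_val).trans β).Homotopic
          ((γ.subpath 0 (t k)).cast γ.source.symm rfl)) := by
    have iUV : ∀ k, γ (t k) ∈ V → (h : γ (t k) ∈ U) → (∃ τ : Path a ⟨γ (t k), h⟩,
        (τ.map continuous_subtype_val).Homotopic ((γ.subpath 0 (t k)).cast γ.source.symm rfl)) →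
        ∃ τ : Path a ⟨x₀, hx₀.1⟩, ∃ β : Path x₀ (γ (t k)), (∀ r, β r ∈ V) ∧
        ((τ.map continuous_subtype_val).trans β).Homotopic
          ((γ.subpath 0 (t k)).cast γ.source.symm rfl) := by
      rintro k hv hu ⟨τ, hτ⟩
      obtain ⟨ω, hω⟩ := hI.joinedIn _ hx₀ _ ⟨hu, hv⟩
      refine ⟨τ.trans (pathIn ω fun r => (hω r).1).symm, ω, fun r => (hω r).2, ?_⟩
      refine Path.Homotopic.trans ?_ hτ
      rw [Path.map_trans]
      have : ((pathIn ω fun r => (hω r).1).symm.map continuous_subtype_val) = ω.symm := rfl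
      rw [this]
      exact (Path.Homotopic.trans_assoc _ _ _).trans
        (((Path.Homotopic.refl _).hcomp (Path.Homotopic.symm_trans ω)).trans
          (Path.Homotopic.trans_refl _))
    have iVU : ∀ k, γ (t k) ∈ V → (h : γ (t k) ∈ U) →
        (∃ τ : Path a ⟨x₀, hx₀.1⟩, ∃ β : Path x₀ (γ (t k)), (∀ r, β r ∈ V) ∧
        ((τ.map continuous_subtype_val).trans β).Homotopic
          ((γ.subpath 0 (t k)).cast γ.source.symm rfl)) → (∃ τ : Path a ⟨γ (t k), h⟩,
        (τ.map continuous_subtype_val).Homotopic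
          ((γ.subpath 0 (t k)).cast γ.source.symm rfl)) := by
      rintro k hv hu ⟨τ, β, hβ, h⟩
      obtain ⟨ω, hω⟩ := hI.joinedIn _ hx₀ _ ⟨hu, hv⟩
      refine ⟨τ.trans (pathIn ω fun r => (hω r).1), ?_⟩
      refine Path.Homotopic.trans ?_ h
      rw [Path.map_trans]
      exact (Path.Homotopic.refl _).hcomp
        (homotopic_of_mem_isSimplyConnected hVs _ _ (fun r => (hω r).2) hβ)
    intro k
    induction k with
    | zero =>
      have A : ∀ h : γ (t 0) ∈ U, ∃ τ : Path a ⟨γ (t 0), h⟩, (τ.map continuous_subtype_val).Homotopic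
          ((γ.subpath 0 (t 0)).cast γ.source.symm rfl) := by
        intro h
        have e : γ (t 0) = a := by rw [t0, γ.source]
        refine ⟨(Path.refl a).cast rfl (Subtype.ext e), ?_⟩
        have : ((γ.subpath 0 (t 0)).cast γ.source.symm rfl) = (((Path.refl a).cast rfl
            (Subtype.ext e) : Path a ⟨γ (t 0), h⟩).map continuous_subtype_val) := by
          ext s
          simp [Path.subpath, t0]
        rw [this]
      refine ⟨A, fun h => iUV 0 h ?_ (A _)⟩
      rw [t0, γ.source]; exact a.2
    | succ k ih =>
      have hle := tm (Nat.le_succ k)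
      have sub : (((γ.subpath 0 (t k)).cast γ.source.symm rfl).trans
          (γ.subpath (t k) (t (k + 1)))).Homotopic
          ((γ.subpath 0 (t (k + 1))).cast γ.source.symm rfl) :=
        ⟨(Path.Homotopy.subpathTransSubpath γ 0 (t k) (t (k + 1))).pathCast γ.source.symm rfl⟩
      obtain ⟨i, hi⟩ := ht k
      have hmem := step k (t (k + 1)) ⟨hle, le_rfl⟩
      cases i with
      | true =>
        have hmem' : ∀ r, γ.subpath (t k) (t (k + 1)) r ∈ U :=
          fun r => image_subset_iff.2 hi (hmem r)
        have hk : γ (t k) ∈ U := hi ⟨le_rfl, hle⟩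
        have A : ∀ h : γ (t (k + 1)) ∈ U, ∃ τ : Path a ⟨γ (t (k + 1)), h⟩,
            (τ.map continuous_subtype_val).Homotopic
            ((γ.subpath 0 (t (k + 1))).cast γ.source.symm rfl) := by
          intro h
          obtain ⟨τ, hτ⟩ := ih.1 hk
          refine ⟨τ.trans (pathIn _ hmem'), ?_⟩
          rw [Path.map_trans]
          exact (hτ.hcomp (Path.Homotopic.refl _)).trans sub
        exact ⟨A, fun h => iUV _ h (hi ⟨hle, le_rfl⟩) (A _)⟩
      | false =>
        have hmem' : ∀ r, γ.subpath (t k) (t (k + 1)) r ∈ V :=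
          fun r => image_subset_iff.2 hi (hmem r)
        have hk : γ (t k) ∈ V := hi ⟨le_rfl, hle⟩
        have A : ∃ τ : Path a ⟨x₀, hx₀.1⟩, ∃ β : Path x₀ (γ (t (k + 1))), (∀ r, β r ∈ V) ∧
            ((τ.map continuous_subtype_val).trans β).Homotopic
              ((γ.subpath 0 (t (k + 1))).cast γ.source.symm rfl) := by
          obtain ⟨τ, β, hβ, h⟩ := ih.2 hk
          refine ⟨τ, β.trans (γ.subpath (t k) (t (k + 1))), fun r => ?_, ?_⟩
          · have hr : (β.trans (γ.subpath (t k) (t (k + 1)))) r ∈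
                range (β.trans (γ.subpath (t k) (t (k + 1)))) := mem_range_self r
            rw [Path.trans_range] at hr
            rcases hr with ⟨s, hs⟩ | ⟨s, hs⟩
            · exact hs ▸ hβ s
            · exact hs ▸ hmem' s
          · exact ((Path.Homotopic.trans_assoc _ _ _).symm.trans
              (h.hcomp (Path.Homotopic.refl _))).trans sub
        exact ⟨fun h => iVU _ (hi ⟨hle, le_rfl⟩) h A, fun _ => A⟩
  have e : γ (t n) = b := by rw [hn n le_rfl, γ.target]
  obtain ⟨τ, hτ⟩ := (key n).1 (by rw [e]; exact b.2)
  refine ⟨τ.cast rfl (Subtype.ext e.symm), ?_⟩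
  have h2 := hτ.pathCast rfl e.symm
  have h3 : ((γ.subpath 0 (t n)).cast γ.source.symm rfl).cast rfl e.symm = γ := by
    ext s
    simp [Path.subpath, hn n le_rfl]
  have aux : ∀ {p q : Path (a : W) b}, p = q → p.Homotopic q := by
    rintro p _ rfl
    exact Path.Homotopic.refl p
  exact h2.trans (aux h3)

end Subdivision

/-- A union of two simply connected open sets with path connected intersection
is simply connected. -/
theorem simplyConnectedSpace_of_isOpen_cover {W : Type*} [TopologicalSpace W] {U V : Set W}
    (hU : IsOpen U) (hV : IsOpen V) (hUV : U ∪ V = univ) (hUs : IsSimplyConnected U)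
    (hVs : IsSimplyConnected V) (hI : IsPathConnected (U ∩ V)) : SimplyConnectedSpace W := by
  have hpc : PathConnectedSpace W := by
    rw [pathConnectedSpace_iff_univ, ← hUV]
    exact hUs.isPathConnected.union hVs.isPathConnected hI.nonempty
  rw [simply_connected_iff_loops_nullhomotopic]
  refine ⟨hpc, ?_⟩
  -- A loop based in `U` deforms into `U` and contracts there; loops based in `V` follow by
  -- exchanging the two sets.
  have main : ∀ {U V : Set W}, IsOpen U → IsOpen V → U ∪ V = univ → IsSimplyConnected U →
      IsSimplyConnected V → IsPathConnected (U ∩ V) → ∀ x ∈ U, ∀ γ : Path x x,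
      γ.Homotopic (Path.refl x) := by
    intro U V hU hV hUV hUs hVs hI x hx γ
    obtain ⟨τ, hτ⟩ := exists_path_homotopic_of_isSimplyConnected hU hV hUV hVs hI
      (a := ⟨x, hx⟩) (b := ⟨x, hx⟩) γ
    have := hUs.simplyConnectedSpace
    exact hτ.symm.trans ((SimplyConnectedSpace.paths_homotopic τ (Path.refl _)).map
      ⟨Subtype.val, continuous_subtype_val⟩)
  intro x γ
  rcases (hUV ▸ mem_univ x : x ∈ U ∪ V) with h | h
  · exact main hU hV hUV hUs hVs hI x h γ
  · exact main hV hU (union_comm U V ▸ hUV) hVs hUs (inter_comm U V ▸ hI) x h γ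

end Superslice

/-! ### Van Kampen, injectivity: a cocycle on segments -/

namespace Superslice

open Topology unitInterval CategoryTheory

/-- The morphism of the fundamental groupoid represented by a path. -/
def pathClass {Y : Type*} [TopologicalSpace Y] {a b : Y} (p : Path a b) :
    FundamentalGroupoid.mk a ⟶ FundamentalGroupoid.mk b :=
  Path.Homotopic.Quotient.mk p

theorem pathClass_trans {Y : Type*} [TopologicalSpace Y] {a b c : Y} (p : Path a b)
    (q : Path b c) : pathClass (p.trans q) = pathClass p ≫ pathClass q := rfl

theorem pathClass_refl {Y : Type*} [TopologicalSpace Y] (a : Y) :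
    pathClass (Path.refl a) = 𝟙 _ := rfl

theorem pathClass_eq_iff {Y : Type*} [TopologicalSpace Y] {a b : Y} {p q : Path a b} :
    pathClass p = pathClass q ↔ p.Homotopic q :=
  Path.Homotopic.Quotient.eq

section Cocycle

variable {W : Type*} [TopologicalSpace W] {U V : Set W} {x₀ : U}
  (θ : ∀ u : U, FundamentalGroupoid.mk x₀ ⟶ FundamentalGroupoid.mk u)
  {E : Type*} [AddCommGroup E] [Module ℝ E]

open Classical in
/-- The `π₁(U, x₀)`-valued cocycle on line segments associated with a map `H : E → W` and a choice
of paths in `U` from `x₀`. It is trivial on segments which `H` does not map into `U`. -/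
def segmentCocycle (H : E → W) (p q : E) : FundamentalGroupoid.mk x₀ ⟶ FundamentalGroupoid.mk x₀ :=
  if h : ∃ (c : U × U) (τ : Path c.1 c.2),
      ∀ t : I, (τ t : W) = H (AffineMap.lineMap p q (t : ℝ)) then
    θ h.choose.1 ≫ pathClass h.choose_spec.choose ≫ Groupoid.inv (θ h.choose.2)
  else 𝟙 _

/-- The choices in the definition are harmless: `U → W` is injective, so `H` determines both the
lifted path and its ends. -/
theorem segmentCocycle_eq (H : E → W) (p q : E) {a b : U} (τ : Path a b)
    (hτ : ∀ t : I, (τ t : W) = H (AffineMap.lineMap p q (t : ℝ))) :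
    segmentCocycle θ H p q =
      θ a ≫ pathClass τ ≫ Groupoid.inv (θ b) := by
  have h : ∃ (c : U × U) (τ : Path c.1 c.2),
      ∀ t : I, (τ t : W) = H (AffineMap.lineMap p q (t : ℝ)) := ⟨(a, b), τ, hτ⟩
  rw [segmentCocycle, dif_pos h]
  have hs := h.choose_spec.choose_spec
  revert hs
  generalize h.choose_spec.choose = ρ
  revert ρ
  generalize h.choose = c
  obtain ⟨a', b'⟩ := c
  intro ρ hs
  have e : ∀ t, ρ t = τ t := fun t => Subtype.ext ((hs t).trans (hτ t).symm)
  obtain rfl : a' = a := by simpa using e 0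
  obtain rfl : b' = b := by simpa using e 1
  obtain rfl : ρ = τ := Path.ext (funext e)
  rfl

/-- The segment cocycle is additive on convex sets that are mapped into `U`, or into a set on which
it is trivial. -/
theorem segmentCocycle_comp [TopologicalSpace E] [IsTopologicalAddGroup E]
    [ContinuousSMul ℝ E]
    (hθ : ∀ (a b : U) (τ : Path a b), (∀ t, (τ t : W) ∈ V) →
      θ a ≫ pathClass τ ≫ Groupoid.inv (θ b) = 𝟙 _)
    {H : E → W} (hH : Continuous H) {D : Set E} (hD : Convex ℝ D)
    (h : MapsTo H D U ∨ MapsTo H D V) {p q r : E} (hp : p ∈ D) (hq : q ∈ D) (hr : r ∈ D) :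
    segmentCocycle θ H p q ≫ segmentCocycle θ H q r = segmentCocycle θ H p r := by
  rcases h with h | h
  · have := hD.contractibleSpace ⟨p, hp⟩
    let f : C(D, U) := ⟨fun x => ⟨H x, h x.2⟩, by fun_prop⟩
    let ρ : ∀ x y : D, Path x y := fun x y =>
      { toFun := fun t => ⟨AffineMap.lineMap (x : E) y (t : ℝ),
          hD.segment_subset x.2 y.2 (by
            rw [segment_eq_image_lineMap]
            exact ⟨t, t.2, rfl⟩)⟩
        continuous_toFun := by
          refine Continuous.subtype_mk ?_ _
          simp only [AffineMap.lineMap_apply_module]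
          fun_prop
        source' := by simp
        target' := by simp }
    have key : ∀ x y : D, segmentCocycle θ H x y = θ (f x) ≫
        pathClass ((ρ x y).map f.continuous) ≫ Groupoid.inv (θ (f y)) := by
      intro x y
      exact segmentCocycle_eq θ H x y ((ρ x y).map f.continuous) fun t => rfl
    have e := key ⟨p, hp⟩ ⟨q, hq⟩
    have e' := key ⟨q, hq⟩ ⟨r, hr⟩
    have e'' := key ⟨p, hp⟩ ⟨r, hr⟩
    dsimp only at e e' e''
    rw [e, e', e'']
    have hh : pathClass ((ρ ⟨p, hp⟩ ⟨r, hr⟩).map f.continuous) =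
        pathClass ((ρ ⟨p, hp⟩ ⟨q, hq⟩).map f.continuous) ≫
        pathClass ((ρ ⟨q, hq⟩ ⟨r, hr⟩).map f.continuous) := by
      rw [← pathClass_trans, pathClass_eq_iff, ← Path.map_trans]
      exact (SimplyConnectedSpace.paths_homotopic _ _).map f
    rw [hh]
    simp
  -- A segment mapped into `V` has trivial value in either case: by `hθ` if it is also mapped into
  -- `U`, and by the default value `𝟙` otherwise.
  · have key : ∀ x ∈ D, ∀ y ∈ D, segmentCocycle θ H x y = 𝟙 _ := by
      intro x hx y hy
      by_cases hc : ∃ (c : U × U) (τ : Path c.1 c.2),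
          ∀ t : I, (τ t : W) = H (AffineMap.lineMap x y (t : ℝ))
      · obtain ⟨⟨a, b⟩, τ, hτ⟩ := hc
        rw [segmentCocycle_eq θ H x y τ hτ]
        refine hθ a b τ fun t => hτ t ▸ h (hD.segment_subset hx hy ?_)
        rw [segment_eq_image_lineMap]
        exact ⟨t, t.2, rfl⟩
      · rw [segmentCocycle, dif_neg hc]
    rw [key p hp q hq, key q hq r hr, key p hp r hr, Category.id_comp]

end Cocycle

/-- Two paths in an open set `U` that are homotopic in the space are homotopic in `U`, if
the complement of `U` is covered by an open set `V` with `U ∩ V` simply connected. -/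
theorem homotopic_of_homotopic_map_val {W : Type*} [TopologicalSpace W] {U V : Set W}
    (hU : IsOpen U) (hV : IsOpen V) (hUV : U ∪ V = univ) (hUc : IsPathConnected U)
    (hI : IsSimplyConnected (U ∩ V)) {a b : U} (γ γ' : Path a b)
    (h : (γ.map continuous_subtype_val).Homotopic (γ'.map continuous_subtype_val)) :
    γ.Homotopic γ' := by
  obtain ⟨x, hx⟩ := hI.nonempty
  let x₀ : U := ⟨x, hx.1⟩
  have hT : IsSimplyConnected ((↑) ⁻¹' V : Set U) := isSimplyConnected_preimage_val hI
  -- Keeping the reference paths inside `V` whenever their end lies in `V` is what makes the cocycle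
  -- trivial on paths in `U ∩ V`.
  have hpath : ∀ u : U, ∃ ρ : Path x₀ u, (u : W) ∈ V → ∀ t, (ρ t : W) ∈ V := by
    intro u
    by_cases hu : (u : W) ∈ V
    · obtain ⟨ρ, hρ⟩ := hT.isPathConnected.joinedIn x₀ hx.2 u hu
      exact ⟨ρ, fun _ => hρ⟩
    · have := isPathConnected_iff_pathConnectedSpace.1 hUc
      exact ⟨PathConnectedSpace.somePath _ _, fun h => absurd h hu⟩
  choose ρ hρ using hpath
  let θ : ∀ u : U, FundamentalGroupoid.mk x₀ ⟶ FundamentalGroupoid.mk u :=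
    fun u => pathClass (ρ u)
  have hθ : ∀ (a b : U) (τ : Path a b), (∀ t, (τ t : W) ∈ V) →
      θ a ≫ pathClass τ ≫ Groupoid.inv (θ b) = 𝟙 _ := by
    intro a b τ hτ
    have ha : (a : W) ∈ V := by simpa using hτ 0
    have hb : (b : W) ∈ V := by simpa using hτ 1
    have e : θ a ≫ pathClass τ = θ b := by
      rw [← pathClass_trans, pathClass_eq_iff]
      refine (homotopic_of_mem_isSimplyConnected hT _ _ (fun t => ?_) (hρ b hb))
      have hr := mem_range_self (f := (ρ a).trans τ) t
      rw [Path.trans_range] at hr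
      rcases hr with ⟨s, hs⟩ | ⟨s, hs⟩
      · exact hs ▸ hρ a ha s
      · exact hs ▸ hτ s
    rw [← Category.assoc, e, Groupoid.comp_inv]
  obtain ⟨F⟩ := h
  -- The homotopy is extended to the plane by clamping, so that segments and convex sets of the
  -- plane can be used freely.
  let G : ℝ × ℝ → W := fun z => F (projIcc 0 1 zero_le_one z.1, projIcc 0 1 zero_le_one z.2)
  have hG : Continuous G := by fun_prop
  obtain ⟨t, t0, tm, ⟨n, hn⟩, ht⟩ := exists_monotone_Icc_subset_open_cover_unitInterval_prod_self
    (c := fun i : Bool => F ⁻¹' (bif i then U else V))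
    (by rintro (_ | _); exacts [hV.preimage F.continuous, hU.preimage F.continuous])
    (by
      intro s _
      rcases (hUV ▸ mem_univ (F s) : F s ∈ U ∪ V) with h | h
      · exact mem_iUnion.2 ⟨true, h⟩
      · exact mem_iUnion.2 ⟨false, h⟩)
  set L := segmentCocycle θ G with hL
  have cell : ∀ j k, ∀ p ∈ Icc (t j : ℝ) (t (j + 1)) ×ˢ Icc (t k : ℝ) (t (k + 1)),
      ∀ q ∈ Icc (t j : ℝ) (t (j + 1)) ×ˢ Icc (t k : ℝ) (t (k + 1)),
      ∀ r ∈ Icc (t j : ℝ) (t (j + 1)) ×ˢ Icc (t k : ℝ) (t (k + 1)),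
      L p q ≫ L q r = L p r := by
    intro j k p hp q hq r hr
    refine segmentCocycle_comp θ hθ hG ((convex_Icc _ _).prod (convex_Icc _ _)) ?_ hp hq hr
    obtain ⟨i, hi⟩ := ht j k
    have hmem : ∀ z ∈ Icc (t j : ℝ) (t (j + 1)) ×ˢ Icc (t k : ℝ) (t (k + 1)),
        G z ∈ bif i then U else V := by
      rintro ⟨z₁, z₂⟩ ⟨h₁, h₂⟩
      have i₁ : z₁ ∈ Icc (0 : ℝ) 1 := ⟨(t j).2.1.trans h₁.1, h₁.2.trans (t (j + 1)).2.2⟩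
      have i₂ : z₂ ∈ Icc (0 : ℝ) 1 := ⟨(t k).2.1.trans h₂.1, h₂.2.trans (t (k + 1)).2.2⟩
      have : (projIcc (0 : ℝ) 1 zero_le_one z₁, projIcc (0 : ℝ) 1 zero_le_one z₂) ∈
          Icc (t j) (t (j + 1)) ×ˢ Icc (t k) (t (k + 1)) := by
        rw [projIcc_of_mem _ i₁, projIcc_of_mem _ i₂]
        exact ⟨h₁, h₂⟩
      exact hi this
    cases i
    · exact Or.inr hmem
    · exact Or.inl hmem
  have tl : ∀ k, (t k : ℝ) ≤ t (k + 1) := fun k => tm (Nat.le_succ k)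
  -- `R j k` is the product of the cocycle along the first `k` steps of the path at homotopy time `t
  -- j`. Additivity on the cells compares consecutive times (`square`), and since the homotopy fixes
  -- the ends the full product is independent of `j` (`rows`).
  let R : ℕ → ℕ → (FundamentalGroupoid.mk x₀ ⟶ FundamentalGroupoid.mk x₀) := fun j k =>
    Nat.rec (𝟙 _) (fun k r => r ≫ L (t j, t k) (t j, t (k + 1))) k
  have Rsucc : ∀ j k, R j (k + 1) = R j k ≫ L (t j, t k) (t j, t (k + 1)) := fun _ _ => rfl
  have square : ∀ j k, R j k ≫ L (t j, t k) (t (j + 1), t k) =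
      L (t j, t 0) (t (j + 1), t 0) ≫ R (j + 1) k := by
    intro j k
    induction k with
    | zero => simp [R]
    | succ k ih =>
      have hj := tl j
      have hk := tl k
      rw [Rsucc, Rsucc, ← Category.assoc, ← ih, Category.assoc, Category.assoc,
        cell j k _ ⟨⟨le_rfl, hj⟩, ⟨le_rfl, hk⟩⟩ _ ⟨⟨le_rfl, hj⟩, ⟨hk, le_rfl⟩⟩ _
          ⟨⟨hj, le_rfl⟩, ⟨hk, le_rfl⟩⟩,
        cell j k _ ⟨⟨le_rfl, hj⟩, ⟨le_rfl, hk⟩⟩ _ ⟨⟨hj, le_rfl⟩, ⟨le_rfl, hk⟩⟩ _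
          ⟨⟨hj, le_rfl⟩, ⟨hk, le_rfl⟩⟩]
  have side : ∀ (c : U) (y x x' : ℝ), (∀ s, G (s, y) = c) → L (x, y) (x', y) = 𝟙 _ := by
    intro c y x x' hc
    rw [hL, segmentCocycle_eq θ G (x, y) (x', y) (Path.refl c) fun s => ?_]
    · rw [pathClass_refl, Category.id_comp, Groupoid.comp_inv]
    · rw [AffineMap.lineMap_apply_module, Prod.smul_mk, Prod.smul_mk, Prod.mk_add_mk, ← add_smul,
        sub_add_cancel, one_smul, hc]
      rfl
  have rows : ∀ j, R 0 n = R j n := by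
    intro j
    induction j with
    | zero => rfl
    | succ j ih =>
      have := square j n
      rw [side b (t n) _ _ fun s => by simp [G, hn n le_rfl],
        side a (t 0) _ _ fun s => by simp [G, t0], Category.comp_id, Category.id_comp] at this
      rw [ih, this]
  -- If the whole path at time `t j` lies in `U`, the product collapses to one segment. This is
  -- applied at the first and last times, where the path is `γ` or `γ'`.
  have row : ∀ j, (∀ s, G (t j, s) ∈ U) → ∀ k, R j k = L (t j, t 0) (t j, t k) := by
    intro j hj k
    have conv : Convex ℝ (({(t j : ℝ)} : Set ℝ) ×ˢ (univ : Set ℝ)) :=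
      (convex_singleton _).prod convex_univ
    have hc := fun p q r hp hq hr => segmentCocycle_comp θ hθ hG conv
      (Or.inl (by rintro ⟨z, w⟩ ⟨rfl, -⟩; exact hj w)) (p := p) (q := q) (r := r) hp hq hr
    induction k with
    | zero =>
      obtain hj0 := hj (t 0)
      change 𝟙 _ = _
      rw [hL, segmentCocycle_eq θ G _ _ (Path.refl (⟨_, hj0⟩ : U)) fun s => by simp]
      rw [pathClass_refl, Category.id_comp, Groupoid.comp_inv]
    | succ k ih =>
      rw [Rsucc, ih]
      exact hc _ _ _ ⟨rfl, trivial⟩ ⟨rfl, trivial⟩ ⟨rfl, trivial⟩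
  have e0 : R 0 n = θ a ≫ pathClass γ ≫ Groupoid.inv (θ b) := by
    rw [row 0 (fun s => by simp [G, t0]) n, hL]
    refine segmentCocycle_eq θ G _ _ γ fun s => ?_
    rw [AffineMap.lineMap_apply_module]
    simp [G, t0, hn n le_rfl]
  have e1 : R n n = θ a ≫ pathClass γ' ≫ Groupoid.inv (θ b) := by
    rw [row n (fun s => by simp [G, hn n le_rfl]) n, hL]
    refine segmentCocycle_eq θ G _ _ γ' fun s => ?_
    rw [AffineMap.lineMap_apply_module]
    simp [G, t0, hn n le_rfl]
  have e2 := rows n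
  rw [e0, e1] at e2
  have e3 : ∀ g g' : FundamentalGroupoid.mk a ⟶ FundamentalGroupoid.mk b,
      θ a ≫ g ≫ Groupoid.inv (θ b) = θ a ≫ g' ≫ Groupoid.inv (θ b) → g = g' := by
    intro g g' h
    rwa [cancel_epi, cancel_mono] at h
  exact pathClass_eq_iff.1 (e3 _ _ e2)

end Superslice

/-! ### Infinite cyclic fundamental groups, gluing, and the 3-sphere -/

namespace Superslice

open Topology

/-- The space is path connected with infinite cyclic fundamental group. -/
def HasInfiniteCyclicPi1 (A : Type*) [TopologicalSpace A] : Prop :=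
  PathConnectedSpace A ∧ ∀ x : A, Nonempty (FundamentalGroup A x ≃* Multiplicative ℤ)

theorem isZSurface_iff {W : Type*} [TopologicalSpace W] {S : Set W} :
    IsZSurface S ↔ HasInfiniteCyclicPi1 ↥Sᶜ := by
  rw [IsZSurface, HasInfiniteCyclicPi1, isPathConnected_iff_pathConnectedSpace]

/-- A map that is full and essentially surjective on fundamental groupoids, and faithful if the
source is path connected, preserves and reflects `HasInfiniteCyclicPi1`. -/
theorem hasInfiniteCyclicPi1_iff_of_map {A B : Type*} [TopologicalSpace A] [TopologicalSpace B]
    (f : C(A, B))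
    (hinj : PathConnectedSpace A → ∀ (a a' : A) (γ γ' : Path a a'),
      (γ.map f.continuous).Homotopic (γ'.map f.continuous) → γ.Homotopic γ')
    (hsurj : ∀ (a a' : A) (γ : Path (f a) (f a')),
      ∃ τ : Path a a', (τ.map f.continuous).Homotopic γ)
    (hess : ∀ b : B, ∃ a : A, Joined (f a) b) :
    HasInfiniteCyclicPi1 A ↔ HasInfiniteCyclicPi1 B := by
  have equiv : PathConnectedSpace A → ∀ a : A,
      Nonempty (FundamentalGroup A a ≃* FundamentalGroup B (f a)) := by
    intro hA a
    refine ⟨MulEquiv.ofBijective (FundamentalGroup.map f a) ⟨?_, ?_⟩⟩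
    · rintro ⟨γ⟩ ⟨γ'⟩ h
      exact Path.Homotopic.Quotient.eq.2 (hinj hA a a γ γ' (Path.Homotopic.Quotient.eq.1 h))
    · rintro ⟨γ⟩
      obtain ⟨τ, hτ⟩ := hsurj a a γ
      exact ⟨Path.Homotopic.Quotient.mk τ, Path.Homotopic.Quotient.eq.2 hτ⟩
  constructor
  · rintro ⟨hA, hZ⟩
    have hB : PathConnectedSpace B :=
      { nonempty := hA.nonempty.map f
        joined := fun b b' => by
          obtain ⟨a, ha⟩ := hess b
          obtain ⟨a', ha'⟩ := hess b'
          obtain ⟨γ⟩ := hA.joined a a'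
          exact ha.symm.trans (Joined.trans ⟨γ.map f.continuous⟩ ha') }
    refine ⟨hB, fun b => ?_⟩
    obtain ⟨a, ⟨γ⟩⟩ := hess b
    obtain ⟨e⟩ := equiv hA a
    obtain ⟨z⟩ := hZ a
    exact ⟨(FundamentalGroup.fundamentalGroupMulEquivOfPath γ).symm.trans (e.symm.trans z)⟩
  · rintro ⟨hB, hZ⟩
    -- Connectedness of `A` comes from lifting paths alone, so it is available before the
    -- injectivity hypothesis, which presupposes it.
    have hA : PathConnectedSpace A :=
      { nonempty := hB.nonempty.elim fun b => (hess b).nonempty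
        joined := fun a a' => by
          obtain ⟨γ⟩ := hB.joined (f a) (f a')
          exact ⟨(hsurj a a' γ).choose⟩ }
    refine ⟨hA, fun a => ?_⟩
    obtain ⟨e⟩ := equiv hA a
    obtain ⟨z⟩ := hZ (f a)
    exact ⟨e.trans z⟩

theorem hasInfiniteCyclicPi1_congr {A B : Type*} [TopologicalSpace A] [TopologicalSpace B]
    (e : A ≃ₜ B) : HasInfiniteCyclicPi1 A ↔ HasInfiniteCyclicPi1 B := by
  have aux : ∀ {a a' : A} {p q : Path a a'}, p = q → p.Homotopic q := by
    rintro a a' p _ rfl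
    exact Path.Homotopic.refl p
  have aux' : ∀ {a a' : B} {p q : Path a a'}, p = q → p.Homotopic q := by
    rintro a a' p _ rfl
    exact Path.Homotopic.refl p
  refine hasInfiniteCyclicPi1_iff_of_map (e : C(A, B)) (fun _ a a' γ γ' h => ?_)
    (fun a a' γ => ?_) fun b => ⟨e.symm b, ?_⟩
  · have h' := (h.map (e.symm : C(B, A))).pathCast (e.symm_apply_apply a).symm
      (e.symm_apply_apply a').symm
    refine (aux ?_).trans (h'.trans (aux ?_)) <;>
    · ext t
      simp
  · refine ⟨(γ.map e.symm.continuous).cast (e.symm_apply_apply a).symm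
      (e.symm_apply_apply a').symm, aux' ?_⟩
    ext t
    simp
  · simpa using Joined.refl b

/-- Gluing a simply connected open set `V` to an open set `U` along a simply connected
intersection does not change whether `π₁` is infinite cyclic. -/
theorem hasInfiniteCyclicPi1_union_iff {Y : Type*} [TopologicalSpace Y] {U V : Set Y}
    (hU : IsOpen U) (hV : IsOpen V) (hVs : IsSimplyConnected V) (hI : IsSimplyConnected (U ∩ V)) :
    HasInfiniteCyclicPi1 U ↔ HasInfiniteCyclicPi1 ↥(U ∪ V) := by
  let W := ↥(U ∪ V)
  have hemb : IsEmbedding ((↑) : W → Y) := IsEmbedding.subtypeVal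
  have im : ∀ S ⊆ U ∪ V, ((↑) : W → Y) '' ((↑) ⁻¹' S) = S := by
    intro S hS
    rw [Subtype.image_preimage_coe, inter_eq_right.2 hS]
  let U' : Set W := (↑) ⁻¹' U
  let V' : Set W := (↑) ⁻¹' V
  have hU' : IsOpen U' := hU.preimage continuous_subtype_val
  have hV' : IsOpen V' := hV.preimage continuous_subtype_val
  have hUV : U' ∪ V' = univ := eq_univ_of_forall fun x => x.2
  have hVs' : IsSimplyConnected V' := by
    rw [← hemb.isSimplyConnected_image, im V subset_union_right]
    exact hVs
  have hI' : IsSimplyConnected (U' ∩ V') := by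
    rw [← hemb.isSimplyConnected_image, ← preimage_inter,
      im _ (inter_subset_left.trans subset_union_left)]
    exact hI
  have e : U ≃ₜ U' :=
    (Homeomorph.setCongr (im U subset_union_left).symm).trans (hemb.homeomorphImage U').symm
  rw [hasInfiniteCyclicPi1_congr e]
  refine hasInfiniteCyclicPi1_iff_of_map ⟨Subtype.val, continuous_subtype_val⟩ ?_ ?_ ?_
  · intro hc a a' γ γ' h
    exact homotopic_of_homotopic_map_val hU' hV' hUV
      (isPathConnected_iff_pathConnectedSpace.2 hc) hI' γ γ' h
  · intro a a' γ
    exact exists_path_homotopic_of_isSimplyConnected hU' hV' hUV hVs' hI'.isPathConnected γ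
  · intro b
    rcases (hUV ▸ mem_univ b : b ∈ U' ∪ V') with hb | hb
    · exact ⟨⟨b, hb⟩, Joined.refl _⟩
    · obtain ⟨x, hx⟩ := hI'.nonempty
      exact ⟨⟨x, hx.1⟩, (hVs'.isPathConnected.joinedIn x hx.2 b hb).joined⟩

/-- The `3`-sphere is simply connected. -/
theorem simplyConnectedSpace_S3 : SimplyConnectedSpace S3 := by
  let v : EuclideanSpace ℝ (Fin 4) := EuclideanSpace.single 0 1
  have hv : ‖v‖ = 1 := by simp [v]
  have hv' : ‖-v‖ = 1 := by rw [norm_neg, hv]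
  have hne : v ≠ -v := by
    intro h
    have h0 : v 0 = -v 0 := congrArg (fun w : EuclideanSpace ℝ (Fin 4) => w 0) h
    norm_num [v] at h0
  -- Stereographic projection identifies the sphere minus a point with a real vector space.
  have hsc : ∀ w : EuclideanSpace ℝ (Fin 4), ∀ hw : ‖w‖ = 1,
      IsSimplyConnected ({⟨w, by simp [hw]⟩}ᶜ : Set S3) := by
    intro w hw
    rw [← range_stereographic_symm hw, ← image_univ,
      (isOpenEmbedding_stereographic_symm hw).isEmbedding.isSimplyConnected_image,
      IsSimplyConnected, (Homeomorph.Set.univ _).toHomotopyEquiv.simplyConnectedSpace_iff]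
    infer_instance
  refine simplyConnectedSpace_of_isOpen_cover (U := {⟨v, by simp [hv]⟩}ᶜ)
    (V := {⟨-v, by simp [hv]⟩}ᶜ) isOpen_compl_singleton isOpen_compl_singleton ?_
    (hsc v hv) (hsc (-v) hv') ?_
  · rw [← compl_inter, ← compl_empty, compl_inj_iff, eq_empty_iff_forall_notMem]
    rintro x ⟨h₁, h₂⟩
    rw [mem_singleton_iff] at h₁ h₂
    exact hne (congrArg Subtype.val (h₁.symm.trans h₂))
  -- The sphere minus two antipodal points is a three-dimensional vector space minus a point.
  · have hdim : 1 < Module.rank ℝ (ℝ ∙ v)ᗮ := by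
      have : Fact (Module.finrank ℝ (EuclideanSpace ℝ (Fin 4)) = 3 + 1) := ⟨by simp⟩
      have h3 : Module.finrank ℝ (ℝ ∙ v)ᗮ = 3 := Submodule.finrank_orthogonal_span_singleton
        (by rintro h; simp [h] at hv)
      rw [← Module.finrank_eq_rank, h3]
      norm_num
    let p : S3 := ⟨-v, by simp [hv]⟩
    have hinj := (isOpenEmbedding_stereographic_symm hv).injective
    have hp : (stereographic hv).symm (stereographic hv p) = p := by
      refine (stereographic hv).left_inv ?_
      rw [stereographic_source, mem_compl_iff, mem_singleton_iff]
      intro h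
      exact hne (congrArg Subtype.val h).symm
    have himg : ({⟨v, by simp [hv]⟩}ᶜ ∩ {⟨-v, by simp [hv]⟩}ᶜ : Set S3) =
        (stereographic hv).symm '' {stereographic hv p}ᶜ := by
      rw [← range_stereographic_symm hv, ← image_univ, ← Set.sdiff_eq, compl_eq_univ_sdiff,
        image_sdiff hinj, image_singleton, hp]
    rw [himg]
    exact (isPathConnected_compl_singleton_of_one_lt_rank hdim _).image
      (isOpenEmbedding_stereographic_symm hv).continuous

end Superslice

/-! ### Extension by the identity and pushing along lines -/

namespace Superslice

open Topology NNReal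

section Extension

open Classical in
/-- A homeomorphism of the target of an open partial homeomorphism, transported to the source and
extended by the identity. -/
def extendById {Y Z : Type*} [TopologicalSpace Y] [TopologicalSpace Z]
    (E : OpenPartialHomeomorph Y Z) (φ : Z → Z) (y : Y) : Y :=
  if y ∈ E.source then E.symm (φ (E y)) else y

variable {Y Z : Type*} [TopologicalSpace Y] [TopologicalSpace Z]
    (E : OpenPartialHomeomorph Y Z)

/-- The open sets `E.source` and `Cᶜ` cover `Y`; on the first the map is a composite of continuous
maps, on the second it is the identity. -/
theorem continuous_extendById {φ : Z → Z} (hφ : Continuous φ) {C : Set Y} (hC : IsClosed C)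
    (hCs : C ⊆ E.source) (hm : MapsTo φ E.target E.target)
    (hfix : ∀ y ∈ E.source, y ∉ C → φ (E y) = E y) : Continuous (extendById E φ) := by
  rw [continuous_iff_continuousAt]
  intro y
  by_cases hy : y ∈ E.source
  · have h : ContinuousOn (fun y => E.symm (φ (E y))) E.source :=
      E.continuousOn_symm.comp (hφ.comp_continuousOn E.continuousOn)
        fun x hx => hm (E.map_source hx)
    refine (h.continuousAt (E.open_source.mem_nhds hy)).congr ?_
    filter_upwards [E.open_source.mem_nhds hy] with x hx
    rw [extendById, if_pos hx]
  · refine continuousAt_id.congr ?_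
    filter_upwards [hC.isOpen_compl.mem_nhds fun h => hy (hCs h)] with x hx
    rw [extendById, id]
    split_ifs with h
    · rw [hfix x h hx, E.left_inv h]
    · rfl

theorem extendById_leftInverse {φ ψ : Z → Z} (h : Function.LeftInverse ψ φ)
    (hm : MapsTo φ E.target E.target) :
    Function.LeftInverse (extendById E ψ) (extendById E φ) := by
  intro y
  by_cases hy : y ∈ E.source
  · have h1 := hm (E.map_source hy)
    have h2 : extendById E φ y = E.symm (φ (E y)) := if_pos hy
    rw [h2, extendById, if_pos (E.map_target h1), E.right_inv h1, h, E.left_inv hy]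
  · have h2 : extendById E φ y = y := if_neg hy
    rw [h2, extendById, if_neg hy]

/-- The homeomorphism of `Y` obtained by extending one with support in `C` by the identity. -/
def extendHomeomorph (φ : Z ≃ₜ Z) {C : Set Y} (hC : IsClosed C)
    (hCs : C ⊆ E.source) (hm : MapsTo φ E.target E.target) (hm' : MapsTo φ.symm E.target E.target)
    (hfix : ∀ y ∈ E.source, y ∉ C → φ (E y) = E y) : Y ≃ₜ Y where
  toFun := extendById E φ
  invFun := extendById E φ.symm
  left_inv := extendById_leftInverse E φ.left_inv hm
  right_inv := extendById_leftInverse E φ.right_inv hm'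
  continuous_toFun := continuous_extendById E φ.continuous hC hCs hm hfix
  continuous_invFun := continuous_extendById E φ.symm.continuous hC hCs hm' fun y hy hyC => by
    rw [Homeomorph.symm_apply_eq, hfix y hy hyC]

end Extension

section LinePush

/-- A piecewise linear map of the line: translation by `-a` on `t ≤ 0`, the identity on
`1 / 2 ≤ t`. -/
def linePush (a t : ℝ) : ℝ := t - a * max 0 (min 1 (1 - 2 * t))

/-- The inverse of `linePush`. -/
def linePull (a u : ℝ) : ℝ := max u (min (u + a) ((u + a) / (1 + 2 * a)))

theorem linePush_of_nonpos {a t : ℝ} (ht : t ≤ 0) : linePush a t = t - a := by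
  rw [linePush, min_eq_left (by linarith), max_eq_right zero_le_one, mul_one]

theorem linePush_of_half_le {a t : ℝ} (ht : 1 / 2 ≤ t) : linePush a t = t := by
  rw [linePush, min_eq_right (by linarith), max_eq_left (by linarith), mul_zero, sub_zero]

theorem linePush_of_mem {a t : ℝ} (h0 : 0 ≤ t) (h1 : t ≤ 1 / 2) :
    linePush a t = t - a * (1 - 2 * t) := by
  rw [linePush, min_eq_right (by linarith), max_eq_right (by linarith)]

theorem linePull_of_le {a u : ℝ} (ha : 0 ≤ a) (hu : u ≤ -a) : linePull a u = u + a := by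
  have h : u + a ≤ (u + a) / (1 + 2 * a) := by
    rw [le_div_iff₀ (by linarith)]
    nlinarith
  rw [linePull, min_eq_left h, max_eq_right (by linarith)]

theorem linePull_of_half_le {a u : ℝ} (ha : 0 ≤ a) (hu : 1 / 2 ≤ u) : linePull a u = u := by
  have h : (u + a) / (1 + 2 * a) ≤ u := by
    rw [div_le_iff₀ (by linarith)]
    nlinarith
  rw [linePull, max_eq_left ((min_le_right _ _).trans h)]

theorem linePull_of_mem {a u : ℝ} (ha : 0 ≤ a) (h0 : -a ≤ u) (h1 : u ≤ 1 / 2) :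
    linePull a u = (u + a) / (1 + 2 * a) := by
  have h : (u + a) / (1 + 2 * a) ≤ u + a := by
    rw [div_le_iff₀ (by linarith)]
    nlinarith
  have h' : u ≤ (u + a) / (1 + 2 * a) := by
    rw [le_div_iff₀ (by linarith)]
    nlinarith
  rw [linePull, min_eq_right h, max_eq_right h']

/-- The slopes of `linePush` are `1`, `1 + 2 * a` and `1`, and the max-min formula for `linePull`
inverts them piece by piece. A single formula makes joint continuity in `a` and `u` immediate. -/
theorem linePull_linePush {a : ℝ} (ha : 0 ≤ a) (t : ℝ) : linePull a (linePush a t) = t := by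
  rcases le_total t 0 with h | h
  · rw [linePush_of_nonpos h, linePull_of_le ha (by linarith), sub_add_cancel]
  · rcases le_total t (1 / 2) with h' | h'
    · rw [linePush_of_mem h h', linePull_of_mem ha (by nlinarith) (by nlinarith)]
      have : 1 + 2 * a ≠ 0 := by positivity
      field_simp
      ring
    · rw [linePush_of_half_le h', linePull_of_half_le ha h']

theorem linePush_linePull {a : ℝ} (ha : 0 ≤ a) (u : ℝ) : linePush a (linePull a u) = u := by
  rcases le_total u (-a) with h | h
  · rw [linePull_of_le ha h, linePush_of_nonpos (by linarith), add_sub_cancel_right]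
  · rcases le_total u (1 / 2) with h' | h'
    · rw [linePull_of_mem ha h h', linePush_of_mem (div_nonneg (by linarith) (by linarith))]
      · have : 1 + 2 * a ≠ 0 := by positivity
        field_simp
        ring
      · rw [div_le_iff₀ (by linarith)]
        linarith
    · rw [linePull_of_half_le ha h', linePush_of_half_le h']

/-- Ensures that the push preserves the target `O ×ˢ Iio 1` of an extended collar chart. -/
theorem linePush_lt_one_iff {a t : ℝ} (ha : 0 ≤ a) : linePush a t < 1 ↔ t < 1 := by
  rcases le_total t (1 / 2) with h | h
  · refine ⟨fun _ => by linarith, fun _ => ?_⟩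
    have : 0 ≤ a * max 0 (min 1 (1 - 2 * t)) := mul_nonneg ha (le_max_left _ _)
    rw [linePush]
    linarith
  · rw [linePush_of_half_le h]

/-- Push down the line `{s} × ℝ` by `l s`. -/
def pushHomeomorph {B : Type*} [TopologicalSpace B] (l : C(B, ℝ)) (hl : ∀ s, 0 ≤ l s) :
    B × ℝ ≃ₜ B × ℝ where
  toFun z := (z.1, linePush (l z.1) z.2)
  invFun z := (z.1, linePull (l z.1) z.2)
  left_inv z := by simp [linePull_linePush (hl z.1)]
  right_inv z := by simp [linePush_linePull (hl z.1)]
  continuous_toFun := by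
    unfold linePush
    fun_prop
  continuous_invFun := by
    unfold linePull
    have : ∀ z : B × ℝ, 1 + 2 * l z.1 ≠ 0 := fun z => by
      have := hl z.1
      positivity
    fun_prop (disch := assumption)

end LinePush

/-! ### Brown's collar theorem -/

section Collar

variable {X B : Type*} [TopologicalSpace X] [TopologicalSpace B]

/-- `e` is a collar chart for `b : B → X` over the set `O`. -/
structure IsLocalCollar (b : B → X) (O : Set B) (e : OpenPartialHomeomorph X (B × ℝ≥0)) :
    Prop where
  target_eq : e.target = O ×ˢ Iio 1
  mem_source : ∀ s ∈ O, b s ∈ e.source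
  apply_eq : ∀ s ∈ O, e (b s) = (s, 0)
  mem_range_iff : ∀ x ∈ e.source, x ∈ range b ↔ (e x).2 = 0

/-- If `b s` is in the source, its image is `(s', 0)` with `s' ∈ O`. This is also the image of `b
s'`, so injectivity of the chart and of `b` gives `s = s'`. -/
theorem IsLocalCollar.mem_source_iff {b : B → X} (hb : Function.Injective b) {O : Set B}
    {e : OpenPartialHomeomorph X (B × ℝ≥0)} (h : IsLocalCollar b O e) (s : B) :
    b s ∈ e.source ↔ s ∈ O := by
  refine ⟨fun hs => ?_, h.mem_source s⟩
  have h1 := e.map_source hs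
  rw [h.target_eq] at h1
  have h2 : e (b (e (b s)).1) = e (b s) := by
    rw [h.apply_eq _ h1.1]
    exact Prod.ext rfl ((h.mem_range_iff _ hs).1 ⟨s, rfl⟩).symm
  have h3 := hb (e.injOn (h.mem_source _ h1.1) hs h2)
  exact h3 ▸ h1.1

/-- `X` with an infinite external collar `B × (-∞, 0]` attached along `b`. -/
abbrev ExternalCollar (b : B → X) : Type _ :=
  {p : X × ℝ // p.2 = 0 ∨ (p.2 ≤ 0 ∧ p.1 ∈ range b)}

/-- The point of the external collar over `s` at height `t`. -/
def collarPoint (b : B → X) (s : B) (t : ℝ) (ht : t ≤ 0) : ExternalCollar b :=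
  ⟨(b s, t), Or.inr ⟨ht, s, rfl⟩⟩

open Classical in
/-- A local collar extended over the external collar. -/
def IsLocalCollar.extend {b : B → X} {O : Set B}
    {e : OpenPartialHomeomorph X (B × ℝ≥0)} (h : IsLocalCollar b O e) :
    OpenPartialHomeomorph (ExternalCollar b) (B × ℝ) := by
  -- The extended chart adds the height inside `X` to the external height, at least one of which is
  -- zero. The inverse recovers them as the positive and negative parts of the sum.
  let inv : B × ℝ → X × ℝ := fun z => (e.symm (z.1, z.2.toNNReal), min z.2 0)
  have hz : ∀ z ∈ O ×ˢ Iio (1 : ℝ), (z.1, z.2.toNNReal) ∈ e.target := by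
    rintro ⟨s, t⟩ ⟨hs, ht⟩
    rw [h.target_eq]
    exact ⟨hs, Real.toNNReal_lt_one.2 ht⟩
  have hinv : ∀ z ∈ O ×ˢ Iio (1 : ℝ), (inv z).2 = 0 ∨ ((inv z).2 ≤ 0 ∧ (inv z).1 ∈ range b) := by
    rintro ⟨s, t⟩ ⟨hs, ht⟩
    rcases le_total t 0 with h0 | h0
    · refine Or.inr ⟨min_le_right _ _, s, ?_⟩
      have h1 := e.left_inv (h.mem_source s hs)
      rw [h.apply_eq s hs] at h1
      simp only [inv]
      rw [Real.toNNReal_of_nonpos h0, h1]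
    · exact Or.inl (min_eq_right h0)
  -- The value chosen in the second branch is irrelevant: over the target the first branch applies.
  let inv' : B × ℝ → ExternalCollar b := fun z =>
    if hz : (inv z).2 = 0 ∨ ((inv z).2 ≤ 0 ∧ (inv z).1 ∈ range b) then ⟨inv z, hz⟩
    else ⟨(b z.1, 0), Or.inl rfl⟩
  have hinv' : ∀ z ∈ O ×ˢ Iio (1 : ℝ), (inv' z).1 = inv z := fun z hz => by
    simp only [inv']
    rw [dif_pos (hinv z hz)]
  exact
  { toFun := fun p => ((e p.1.1).1, ((e p.1.1).2 : ℝ) + p.1.2)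
    invFun := inv'
    source := {p | p.1.1 ∈ e.source}
    target := O ×ˢ Iio 1
    map_source' := by
      rintro ⟨⟨x, t⟩, hp⟩ hx
      have h1 := e.map_source hx
      rw [h.target_eq] at h1
      refine ⟨h1.1, ?_⟩
      have ht : t ≤ 0 := hp.elim le_of_eq fun h => h.1
      have h2 : ((e x).2 : ℝ) < 1 := h1.2
      change ((e x).2 : ℝ) + t < 1
      linarith
    map_target' := by
      intro z h'
      change (inv' z).1.1 ∈ e.source
      rw [hinv' z h']
      exact e.map_target (hz z h')
    left_inv' := by
      rintro ⟨⟨x, t⟩, hp⟩ hx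
      have h1 := e.map_source hx
      rw [h.target_eq] at h1
      have ht : t ≤ 0 := hp.elim le_of_eq fun h => h.1
      have h2 : ((e x).2 : ℝ) < 1 := h1.2
      refine Subtype.ext ?_
      rw [hinv' _ ⟨h1.1, (by change ((e x).2 : ℝ) + t < 1; linarith)⟩]
      have hp' := hp
      rcases hp' with h0 | ⟨-, hb⟩
      · simp only at h0
        simp only [inv, h0, add_zero, Real.toNNReal_coe]
        rw [min_eq_right (by positivity)]
        exact Prod.ext (e.left_inv hx) rfl
      · have h3 := (h.mem_range_iff x hx).1 hb
        simp only [inv, h3, NNReal.coe_zero, zero_add]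
        rw [Real.toNNReal_of_nonpos ht, min_eq_left ht, ← h3]
        exact Prod.ext (e.left_inv hx) rfl
    right_inv' := by
      rintro ⟨s, t⟩ h'
      rw [hinv' _ h']
      simp only [inv]
      rw [e.right_inv (hz _ h')]
      refine Prod.ext rfl ?_
      rw [Real.coe_toNNReal']
      exact max_add_min t 0 |>.trans (add_zero t)
    open_source := e.open_source.preimage (by fun_prop)
    open_target := by
      have : O = (fun s : B => (s, (0 : ℝ≥0))) ⁻¹' e.target := by
        rw [h.target_eq]
        ext s
        simp
      exact IsOpen.prod (this ▸ e.open_target.preimage (by fun_prop)) isOpen_Iio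
    continuousOn_toFun := by
      have h1 : ContinuousOn (fun p : ExternalCollar b => e p.1.1) {p | p.1.1 ∈ e.source} :=
        e.continuousOn.comp (by fun_prop) fun p hp => hp
      exact (h1.fst).prodMk ((NNReal.continuous_coe.comp_continuousOn h1.snd).add (by fun_prop))
    continuousOn_invFun := by
      rw [IsEmbedding.subtypeVal.continuousOn_iff]
      have h1 : ContinuousOn inv (O ×ˢ Iio 1) :=
        (e.continuousOn_symm.comp (f := fun z : B × ℝ => (z.1, z.2.toNNReal))
          (by fun_prop) hz).prodMk (by fun_prop)
      exact h1.congr hinv' }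

theorem IsLocalCollar.extend_symm_apply {b : B → X} {O : Set B}
    {e : OpenPartialHomeomorph X (B × ℝ≥0)} (h : IsLocalCollar b O e) {s : B} (hs : s ∈ O)
    {t : ℝ} (ht : t ≤ 0) : (h.extend.symm (s, t)).1 = (b s, t) := by
  have h1 := h.extend.left_inv (x := collarPoint b s t ht) (h.mem_source s hs)
  have h2 : h.extend (collarPoint b s t ht) = (s, t) := by
    change ((e (b s)).1, ((e (b s)).2 : ℝ) + t) = _
    rw [h.apply_eq s hs]
    simp
  rw [h2] at h1
  rw [h1]
  rfl

/-- In the extended chart, lines are pushed down by `l`. Nothing moves off the support of `l` or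
above height `1 / 2`, so the push extends by the identity. -/
theorem IsLocalCollar.exists_push [T2Space X] [CompactSpace B] {b : B → X}
    (hb : Function.Injective b) {O : Set B}
    {e : OpenPartialHomeomorph X (B × ℝ≥0)} (h : IsLocalCollar b O e) (l : C(B, ℝ))
    (hl : ∀ s, 0 ≤ l s) (hlO : tsupport l ⊆ O) :
    ∃ Θ : ExternalCollar b ≃ₜ ExternalCollar b, ∀ s t (ht : t ≤ 0),
      (Θ (collarPoint b s t ht)).1 = (b s, t - l s) := by
  have hsub : tsupport l ×ˢ Iic (1 / 2 : ℝ≥0) ⊆ e.target := by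
    rw [h.target_eq]
    refine prod_mono hlO fun t (ht : t ≤ 1 / 2) => show t < 1 from lt_of_le_of_lt ht ?_
    exact half_lt_self one_pos
  have hK : IsCompact (e.symm '' (tsupport l ×ˢ Iic (1 / 2 : ℝ≥0))) := by
    refine IsCompact.image_of_continuousOn ?_ (e.continuousOn_symm.mono hsub)
    refine (isClosed_tsupport l).isCompact.prod ?_
    rw [← Icc_bot]
    exact isCompact_Icc
  -- Only the coordinate in `X` is constrained, so `C` contains the whole external collar over the
  -- support of `l`. It is closed because a compact subset of the Hausdorff space `X` is closed.
  let C : Set (ExternalCollar b) := {p | p.1.1 ∈ e.symm '' (tsupport l ×ˢ Iic (1 / 2 : ℝ≥0))}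
  have hC : IsClosed C := hK.isClosed.preimage (by fun_prop)
  have hCs : C ⊆ h.extend.source := by
    rintro p ⟨z, hz, hzp⟩
    change p.1.1 ∈ e.source
    rw [← hzp]
    exact e.map_target (hsub hz)
  have hm : ∀ z, pushHomeomorph l hl z ∈ O ×ˢ Iio (1 : ℝ) ↔ z ∈ O ×ˢ Iio (1 : ℝ) := by
    rintro ⟨s, t⟩
    exact and_congr_right fun _ => linePush_lt_one_iff (hl s)
  have hfix : ∀ p ∈ h.extend.source, p ∉ C → pushHomeomorph l hl (h.extend p) = h.extend p := by
    rintro ⟨⟨x, t⟩, hp⟩ hx hpC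
    change x ∈ e.source at hx
    have h1 : ¬ ((e x).1 ∈ tsupport l ∧ (e x).2 ≤ 1 / 2) := fun h1 =>
      hpC ⟨e x, h1, e.left_inv hx⟩
    refine Prod.ext rfl ?_
    change linePush (l (e x).1) (((e x).2 : ℝ) + t) = ((e x).2 : ℝ) + t
    by_cases h2 : (e x).1 ∈ tsupport l
    · have h3 : 1 / 2 < (e x).2 := not_le.1 fun h3 => h1 ⟨h2, h3⟩
      have h4 : (1 / 2 : ℝ) < (e x).2 := by exact_mod_cast h3
      have ht : t = 0 := by
        refine hp.resolve_right fun h5 => ?_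
        have := (h.mem_range_iff x hx).1 h5.2
        rw [this, NNReal.coe_zero] at h4
        norm_num at h4
      rw [ht, add_zero, linePush_of_half_le h4.le]
    · rw [image_eq_zero_of_notMem_tsupport h2, linePush, zero_mul, sub_zero]
  refine ⟨extendHomeomorph h.extend (pushHomeomorph l hl) hC hCs (fun z hz => (hm z).2 hz)
    (fun z hz => (hm _).1 (by rwa [Homeomorph.apply_symm_apply])) hfix, fun s t ht => ?_⟩
  change (extendById h.extend _ _).1 = _
  by_cases hs : s ∈ O
  · have h1 : collarPoint b s t ht ∈ h.extend.source := h.mem_source s hs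
    rw [extendById, if_pos h1]
    have h2 : h.extend (collarPoint b s t ht) = (s, t) := by
      change ((e (b s)).1, ((e (b s)).2 : ℝ) + t) = _
      rw [h.apply_eq s hs]
      simp
    rw [h2]
    change (h.extend.symm (s, linePush (l s) t)).1 = _
    rw [linePush_of_nonpos ht, h.extend_symm_apply hs (by linarith [hl s])]
  · have h3 : l s = 0 := image_eq_zero_of_notMem_tsupport fun h' => hs (hlO h')
    have h4 : collarPoint b s t ht ∉ h.extend.source := fun h' =>
      hs ((h.mem_source_iff hb s).1 h')
    rw [extendById, if_neg h4, h3, sub_zero]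
    rfl

/-- Brown's collar theorem: a locally collared compact subspace is collared. -/
theorem exists_collar [T2Space X] [CompactSpace B] {b : B → X} (hb : IsEmbedding b)
    (hloc : ∀ s, ∃ O, s ∈ O ∧ ∃ e, IsLocalCollar b O e) :
    ∃ c : B × Ico (0 : ℝ) 1 → X, IsOpenEmbedding c ∧ ∀ s, c (s, ⟨0, by norm_num⟩) = b s := by
  have : T2Space B := hb.t2Space
  choose O hsO e he using hloc
  have hO : ∀ s, IsOpen (O s) := by
    intro s
    have : O s = (fun s : B => (s, (0 : ℝ≥0))) ⁻¹' (e s).target := by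
      rw [(he s).target_eq]
      ext s
      simp
    exact this ▸ (e s).open_target.preimage (by fun_prop)
  obtain ⟨T, hT⟩ := isCompact_univ.elim_finite_subcover O hO fun s _ => mem_iUnion.2 ⟨s, hsO s⟩
  obtain ⟨l, hl⟩ := PartitionOfUnity.exists_isSubordinate isClosed_univ
    (fun i : T => O i) (fun i => hO i) (by simpa [iUnion_subtype] using hT)
  -- Composing the pushes for all members of a partition of unity moves the external collar down by
  -- exactly one unit. The inverse then carries its part of heights `[-1, 0)` into `X`, as the
  -- desired collar.
  have push : ∀ I : Finset T, ∃ Θ : ExternalCollar b ≃ₜ ExternalCollar b, ∀ s t (ht : t ≤ 0),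
      (Θ (collarPoint b s t ht)).1 = (b s, t - ∑ i ∈ I, l i s) := by
    classical
    intro I
    induction I using Finset.induction_on with
    | empty => exact ⟨Homeomorph.refl _, fun s t ht => by simp [collarPoint]⟩
    | insert i I hi ih =>
      obtain ⟨Θ, hΘ⟩ := ih
      obtain ⟨Φ, hΦ⟩ := (he i).exists_push hb.injective (l i) (l.nonneg i) (hl i)
      refine ⟨Θ.trans Φ, fun s t ht => ?_⟩
      have h0 : t - ∑ i ∈ I, l i s ≤ 0 := by
        have : 0 ≤ ∑ i ∈ I, l i s := Finset.sum_nonneg fun i _ => l.nonneg i s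
        linarith
      have h1 : Θ (collarPoint b s t ht) =
          collarPoint b s (t - ∑ i ∈ I, l i s) h0 := Subtype.ext (hΘ s t ht)
      rw [Homeomorph.trans_apply, h1, hΦ _ _ h0, Finset.sum_insert hi]
      congr 1
      ring
  obtain ⟨Θ, hΘ⟩ := push Finset.univ
  have hsum : ∀ s, ∑ i, l i s = 1 := by
    intro s
    rw [← finsum_eq_sum_of_fintype]
    exact l.sum_eq_one (mem_univ s)
  simp only [hsum] at hΘ
  let j : B × Ico (0 : ℝ) 1 → ExternalCollar b := fun z =>
    ⟨(b z.1, z.2 - 1), Or.inr ⟨by linarith [z.2.2.2], z.1, rfl⟩⟩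
  have hj : Continuous j := by
    have := hb.continuous
    fun_prop
  -- A collar point at height `t ≤ 0` is pushed to `t - 1`, while the heights of `j` are at least
  -- `-1`; so a preimage has height `0`.
  have hj0 : ∀ z, (Θ.symm (j z)).1.2 = 0 := by
    intro z
    rcases (Θ.symm (j z)).2 with h | ⟨h, s, hs⟩
    · exact h
    · by_contra hne
      have h1 := hΘ s _ h
      have h2 : collarPoint b s (Θ.symm (j z)).1.2 h =
          Θ.symm (j z) := Subtype.ext (Prod.ext hs rfl)
      rw [h2, Homeomorph.apply_symm_apply] at h1
      have h3 : (z.2 : ℝ) - 1 = (Θ.symm (j z)).1.2 - 1 := congrArg Prod.snd h1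
      exact hne (le_antisymm h (by linarith [z.2.2.1]))
  let i : X → ExternalCollar b := fun x => ⟨(x, 0), Or.inl rfl⟩
  have hi : Continuous i := by fun_prop
  let c : B × Ico (0 : ℝ) 1 → X := fun z => (Θ.symm (j z)).1.1
  have hic : ∀ z, Θ (i (c z)) = j z := by
    intro z
    rw [← Homeomorph.eq_symm_apply]
    exact Subtype.ext (Prod.ext rfl (hj0 z).symm)
  have hrange : range c = {x | (Θ (i x)).1.2 < 0} := by
    ext x
    constructor
    · rintro ⟨z, rfl⟩
      change (Θ (i (c z))).1.2 < 0
      rw [hic]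
      change (z.2 : ℝ) - 1 < 0
      linarith [z.2.2.2]
    · intro hx
      change (Θ (i x)).1.2 < 0 at hx
      obtain ⟨h, s, hs⟩ := (Θ (i x)).2.resolve_left hx.ne
      -- A point below height `-1` comes from a strictly negative external height, whereas `i x` has
      -- height `0`.
      have hge : -1 ≤ (Θ (i x)).1.2 := by
        by_contra hlt
        push Not at hlt
        have h1 := hΘ s ((Θ (i x)).1.2 + 1) (by linarith)
        have h2 := Θ.injective (Subtype.ext
          (h1.trans (Prod.ext hs (add_sub_cancel_right _ _)) : _ = (Θ (i x)).1))
        have h3 : (Θ (i x)).1.2 + 1 = 0 := congrArg (fun p => p.1.2) h2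
        linarith
      refine ⟨(s, ⟨(Θ (i x)).1.2 + 1, by linarith, by linarith⟩), ?_⟩
      have h1 : j (s, ⟨(Θ (i x)).1.2 + 1, by linarith, by linarith⟩) = Θ (i x) := by
        refine Subtype.ext (Prod.ext hs ?_)
        exact add_sub_cancel_right _ _
      simp only [c]
      rw [h1, Homeomorph.symm_apply_apply]
  have hind : IsEmbedding j := by
    have hf : IsEmbedding fun z : B × Ico (0 : ℝ) 1 => (b z.1, (z.2 : ℝ) - 1) :=
      hb.prodMap ((Homeomorph.subRight (1 : ℝ)).isEmbedding.comp IsEmbedding.subtypeVal)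
    exact IsEmbedding.of_comp hj continuous_subtype_val hf
  refine ⟨c, ⟨?_, ?_⟩, fun s => ?_⟩
  · refine IsEmbedding.of_comp (continuous_fst.comp (continuous_subtype_val.comp
      (Θ.symm.continuous.comp hj))) (Θ.continuous.comp hi) ?_
    convert hind using 1
    exact funext hic
  · rw [hrange]
    exact isOpen_Iio.preimage (f := fun x => (Θ (i x)).1.2) (by fun_prop)
  · have h1 : Θ (collarPoint b s 0 le_rfl) = j (s, ⟨0, by norm_num⟩) :=
      Subtype.ext (hΘ s 0 le_rfl)
    simp only [c]
    rw [← h1, Homeomorph.symm_apply_apply]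
    rfl

end Collar

end Superslice

/-! ### Local collars from half-space charts -/

namespace Superslice

open Topology NNReal

/-- The height of a point of the half-space above its boundary. -/
def halfSpaceHeight (y : EuclideanHalfSpace 4) : ℝ≥0 := ⟨y.1 0, y.2⟩

/-- The point of the half-space vertically above or below `y` at height `r`. -/
def setHeight (y : EuclideanHalfSpace 4) (r : ℝ≥0) : EuclideanHalfSpace 4 :=
  ⟨WithLp.toLp 2 (Function.update (WithLp.ofLp y.1) 0 (r : ℝ)), by simp⟩

theorem halfSpaceHeight_setHeight (y : EuclideanHalfSpace 4) (r : ℝ≥0) :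
    halfSpaceHeight (setHeight y r) = r := by
  ext
  change Function.update (WithLp.ofLp y.1) 0 (r : ℝ) 0 = r
  simp

theorem setHeight_halfSpaceHeight (y : EuclideanHalfSpace 4) :
    setHeight y (halfSpaceHeight y) = y := by
  refine Subtype.ext (WithLp.ofLp_injective 2 ?_)
  change Function.update (WithLp.ofLp y.1) 0 (y.1 0) = _
  simp

theorem setHeight_setHeight (y : EuclideanHalfSpace 4) (r r' : ℝ≥0) :
    setHeight (setHeight y r) r' = setHeight y r' := by
  refine Subtype.ext (WithLp.ofLp_injective 2 ?_)
  simp [setHeight]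

theorem continuous_halfSpaceHeight : Continuous halfSpaceHeight := by
  unfold halfSpaceHeight
  fun_prop

theorem continuous_setHeight :
    Continuous fun z : EuclideanHalfSpace 4 × ℝ≥0 => setHeight z.1 z.2 := by
  unfold setHeight
  refine Continuous.subtype_mk ?_ _
  refine (PiLp.continuous_toLp 2 _).comp ?_
  exact Continuous.update (by fun_prop) 0 (by fun_prop)

/-- A half-space chart around a boundary point gives a local collar. -/
theorem exists_isLocalCollar_of_chart {X B : Type*} [TopologicalSpace X] [TopologicalSpace B]
    {b : B → X} (hb : IsEmbedding b) (s₀ : B) (e : OpenPartialHomeomorph X (EuclideanHalfSpace 4))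
    (hs₀ : b s₀ ∈ e.source) (he : ∀ y ∈ e.source, y ∈ range b ↔ (e y).1 0 = 0) :
    ∃ O, s₀ ∈ O ∧ ∃ e', IsLocalCollar b O e' := by
  have he' : ∀ y ∈ e.source, y ∈ range b ↔ halfSpaceHeight (e y) = 0 := by
    intro y hy
    rw [he y hy, ← NNReal.coe_eq_zero]
    rfl
  have hset : ∀ s, b s ∈ e.source → setHeight (e (b s)) 0 = e (b s) := by
    intro s hs
    conv_rhs => rw [← setHeight_halfSpaceHeight (e (b s)), (he' _ hs).1 ⟨s, rfl⟩]
  -- A box around the boundary point on which all vertical segments of height below `ε` stay in the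
  -- chart.
  obtain ⟨N, hN, hqN, ε, hε, hNε⟩ : ∃ N : Set (EuclideanHalfSpace 4), IsOpen N ∧ e (b s₀) ∈ N ∧
      ∃ ε : ℝ≥0, 0 < ε ∧ ∀ y ∈ N, ∀ r < ε, setHeight y r ∈ e.target := by
    have h1 : (fun z : EuclideanHalfSpace 4 × ℝ≥0 => setHeight z.1 z.2) ⁻¹' e.target ∈
        𝓝 (e (b s₀), (0 : ℝ≥0)) := by
      refine (e.open_target.preimage continuous_setHeight).mem_nhds ?_
      change setHeight (e (b s₀)) 0 ∈ e.target
      rw [hset s₀ hs₀]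
      exact e.map_source hs₀
    obtain ⟨N, hN, R, hR, hNR⟩ := mem_nhds_prod_iff.1 h1
    obtain ⟨ε, hε, hεR⟩ := NNReal.nhds_zero_basis.mem_iff.1 hR
    obtain ⟨N', hN'N, hN', hq⟩ := mem_nhds_iff.1 hN
    exact ⟨N', hN', hq, ε, hε, fun y hy r hr => hNR (mk_mem_prod (hN'N hy) (hεR hr))⟩
  have hε' : ε ≠ 0 := hε.ne'
  let O : Set B := {s | b s ∈ e.source ∧ e (b s) ∈ N}
  have : Nonempty B := ⟨s₀⟩
  let binv : X → B := Function.invFun b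
  have hbinv : ∀ s, binv (b s) = s := Function.leftInverse_invFun hb.injective
  have hbc : ContinuousOn binv (range b) := by
    rintro _ ⟨s, rfl⟩
    rw [ContinuousWithinAt, hbinv, ← image_univ, ← hb.map_nhdsWithin_eq, Filter.tendsto_map'_iff,
      nhdsWithin_univ]
    exact Filter.tendsto_id.congr fun s => (hbinv s).symm
  -- `foot` is the vertical projection to the boundary in the chart. Together with the height
  -- divided by `ε` it gives the collar coordinates.
  let foot : X → X := fun x => e.symm (setHeight (e x) 0)
  let S : Set X := {x | x ∈ e.source ∧ halfSpaceHeight (e x) < ε ∧ setHeight (e x) 0 ∈ N}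
  have hfoot : ∀ x ∈ S, foot x ∈ e.source ∧ e (foot x) = setHeight (e x) 0 ∧ foot x ∈ range b := by
    rintro x ⟨hx, hxε, hxN⟩
    have h1 : setHeight (e x) 0 ∈ e.target := by
      rw [← setHeight_setHeight (e x) 0 0]
      exact hNε _ hxN 0 hε
    have h2 := e.map_target h1
    have h3 : e (foot x) = setHeight (e x) 0 := e.right_inv h1
    exact ⟨h2, h3, (he' _ h2).2 (by rw [h3, halfSpaceHeight_setHeight])⟩
  have hbfoot : ∀ x ∈ S, b (binv (foot x)) = foot x := by
    intro x hx
    obtain ⟨s, hs⟩ := (hfoot x hx).2.2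
    rw [← hs, hbinv]
  have hlift : ∀ s ∈ O, ∀ r < (1 : ℝ≥0), setHeight (e (b s)) (ε * r) ∈ e.target := by
    intro s hs r hr
    exact hNε _ hs.2 _ (mul_lt_of_lt_one_right hε hr)
  have hOopen : IsOpen O := by
    have h1 : IsOpen (e.source ∩ e ⁻¹' N) := e.isOpen_inter_preimage hN
    exact h1.preimage hb.continuous
  have hset0 : Continuous fun y : EuclideanHalfSpace 4 => setHeight y 0 :=
    continuous_setHeight.comp (by fun_prop : Continuous fun y => (y, (0 : ℝ≥0)))
  have hSopen : IsOpen S := by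
    have h1 : IsOpen {y : EuclideanHalfSpace 4 | halfSpaceHeight y < ε ∧ setHeight y 0 ∈ N} :=
      (isOpen_Iio.preimage continuous_halfSpaceHeight).inter
        (hN.preimage hset0)
    exact e.isOpen_inter_preimage h1
  have hcS : ContinuousOn (fun x => setHeight (e x) 0) S :=
    hset0.comp_continuousOn
      (e.continuousOn.mono fun x hx => hx.1)
  have hback : ∀ s ∈ O, ∀ r < (1 : ℝ≥0), foot (e.symm (setHeight (e (b s)) (ε * r))) = b s := by
    intro s hs r hr
    simp only [foot]
    rw [e.right_inv (hlift s hs r hr), setHeight_setHeight, hset s hs.1, e.left_inv hs.1]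
  have hinS : ∀ s ∈ O, ∀ r < (1 : ℝ≥0), e.symm (setHeight (e (b s)) (ε * r)) ∈ S := by
    intro s hs r hr
    refine ⟨e.map_target (hlift s hs r hr), ?_, ?_⟩ <;> rw [e.right_inv (hlift s hs r hr)]
    · rw [halfSpaceHeight_setHeight]
      exact mul_lt_of_lt_one_right hε hr
    · rw [setHeight_setHeight, hset s hs.1]
      exact hs.2
  let e' : OpenPartialHomeomorph X (B × ℝ≥0) :=
    { toFun := fun x => (binv (foot x), halfSpaceHeight (e x) / ε)
      invFun := fun z => e.symm (setHeight (e (b z.1)) (ε * z.2))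
      source := S
      target := O ×ˢ Iio 1
      map_source' := by
        intro x hx
        refine ⟨⟨?_, ?_⟩, ?_⟩
        · rw [hbfoot x hx]
          exact (hfoot x hx).1
        · rw [hbfoot x hx, (hfoot x hx).2.1]
          exact hx.2.2
        · exact (div_lt_one₀ hε).2 hx.2.1
      map_target' := fun z hz => hinS _ hz.1 _ hz.2
      left_inv' := by
        intro x hx
        simp only
        rw [hbfoot x hx, (hfoot x hx).2.1, setHeight_setHeight, mul_div_cancel₀ _ hε',
          setHeight_halfSpaceHeight, e.left_inv hx.1]
      right_inv' := by
        rintro ⟨s, r⟩ ⟨hs, hr⟩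
        simp only
        rw [hback s hs r hr, hbinv, e.right_inv (hlift s hs r hr), halfSpaceHeight_setHeight,
          mul_div_cancel_left₀ _ hε']
      open_source := hSopen
      open_target := hOopen.prod isOpen_Iio
      continuousOn_toFun := by
        refine ContinuousOn.prodMk ?_ ?_
        · refine hbc.comp (e.continuousOn_symm.comp hcS fun x hx => ?_) fun x hx =>
            (hfoot x hx).2.2
          rw [← (hfoot x hx).2.1]
          exact e.map_source (hfoot x hx).1
        · exact (continuous_halfSpaceHeight.comp_continuousOn
            (e.continuousOn.mono fun x hx => hx.1)).div_const ε
      continuousOn_invFun := by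
        refine e.continuousOn_symm.comp (continuous_setHeight.comp_continuousOn
          (f := fun z : B × ℝ≥0 => (e (b z.1), ε * z.2)) ?_) fun z hz => hlift _ hz.1 _ hz.2
        refine ContinuousOn.prodMk ?_ (by fun_prop)
        exact e.continuousOn.comp (hb.continuous.comp continuous_fst).continuousOn
          fun z hz => hz.1.1 }
  have happ : ∀ s ∈ O, e' (b s) = (s, 0) := by
    intro s hs
    have h1 : halfSpaceHeight (e (b s)) = 0 := (he' _ hs.1).1 ⟨s, rfl⟩
    change (binv (e.symm (setHeight (e (b s)) 0)), halfSpaceHeight (e (b s)) / ε) = (s, 0)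
    rw [hset s hs.1, e.left_inv hs.1, hbinv, h1, zero_div]
  refine ⟨O, ⟨hs₀, hqN⟩, e', rfl, fun s hs => ?_, happ, fun x hx => ?_⟩
  · have h1 := hinS s hs 0 one_pos
    rwa [mul_zero, hset s hs.1, e.left_inv hs.1] at h1
  · rw [he' x hx.1]
    change _ ↔ halfSpaceHeight (e x) / ε = 0
    rw [div_eq_zero_iff, or_iff_left hε']

theorem IsFourManifoldBoundedBy.exists_collar {X : Type*} [TopologicalSpace X] {b : S3 → X}
    (hX : IsFourManifoldBoundedBy X b) :
    ∃ c : S3 × Ico (0 : ℝ) 1 → X, IsOpenEmbedding c ∧ ∀ s, c (s, ⟨0, by norm_num⟩) = b s := by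
  have := hX.t2
  refine Superslice.exists_collar hX.isEmbedding fun s => ?_
  obtain ⟨e, he, h⟩ := hX.chart (b s)
  exact exists_isLocalCollar_of_chart hX.isEmbedding s e he h

end Superslice

/-! ### Topology of doubles -/

namespace Superslice

open Topology unitInterval

section Double

variable {X : Type*} {A F : Set X}

/-- The inclusion of the two copies of `X` into the double of `X`. -/
def Double.mk (A : Set X) (p : X × Bool) : Double A := Quotient.mk (doubleSetoid A) p

theorem Double.mk_surjective (A : Set X) : Function.Surjective (Double.mk A) :=
  Quotient.mk_surjective

theorem Double.mk_eq_iff {p q : X × Bool} :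
    Double.mk A p = Double.mk A q ↔ p.1 = q.1 ∧ (p.2 = q.2 ∨ p.1 ∈ A) :=
  Quotient.eq (r := doubleSetoid A)

theorem Double.mk_mem_doubleSet {p : X × Bool} : Double.mk A p ∈ doubleSet A F ↔ p.1 ∈ F := by
  constructor
  · rintro ⟨q, hq, h⟩
    rw [← (Double.mk_eq_iff.1 h).1]
    exact hq
  · exact fun h => ⟨p, h, rfl⟩

/-- The folding map of the double. -/
def Double.fold (A : Set X) : Double A → X :=
  Quotient.lift Prod.fst fun _ _ h => h.1

variable {M : Type*} {B : Set M} {c : M → X}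

/-- The map of doubles induced by a map of pairs. -/
def Double.map (c : M → X) (h : MapsTo c B A) : Double B → Double A :=
  Quotient.map (fun p => (c p.1, p.2)) fun _ _ hpq => ⟨congrArg c hpq.1, hpq.2.imp id fun hp => h hp⟩

theorem Double.mk_mem_image_map {h : MapsTo c B A} {G : Set M} {p : X × Bool} :
    Double.mk A p ∈ Double.map c h '' (doubleSet B G)ᶜ ↔ ∃ m ∉ G, c m = p.1 := by
  constructor
  · rintro ⟨z, hz, hzp⟩
    obtain ⟨q, rfl⟩ := Double.mk_surjective B z
    exact ⟨q.1, fun hq => hz (Double.mk_mem_doubleSet.2 hq),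
      (Double.mk_eq_iff (p := (c q.1, q.2)).1 hzp).1⟩
  · rintro ⟨m, hm, hmp⟩
    exact ⟨Double.mk B (m, p.2), fun h => hm (Double.mk_mem_doubleSet.1 h),
      congrArg (Double.mk A) (Prod.ext hmp rfl)⟩

variable [TopologicalSpace X]

theorem Double.isQuotientMap_mk (A : Set X) : IsQuotientMap (Double.mk A) :=
  isQuotientMap_quotient_mk'

/-- The folding map is a continuous left inverse. -/
theorem Double.isEmbedding_mk (A : Set X) (i : Bool) :
    IsEmbedding fun x : X => Double.mk A (x, i) := by
  have h1 : Continuous (Double.fold A) := continuous_quot_lift _ continuous_fst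
  exact Function.LeftInverse.isEmbedding (f := Double.fold A) (fun x => rfl) h1
    ((Double.isQuotientMap_mk A).continuous.comp (by fun_prop))

theorem Double.isOpen_image_mk {O : Set X} (hO : IsOpen O) (hOA : Disjoint O A) (i : Bool) :
    IsOpen ((fun x : X => Double.mk A (x, i)) '' O) := by
  rw [← (Double.isQuotientMap_mk A).isOpen_preimage]
  have : Double.mk A ⁻¹' ((fun x : X => Double.mk A (x, i)) '' O) = O ×ˢ {i} := by
    ext ⟨y, j⟩
    constructor
    · rintro ⟨x, hx, h⟩
      obtain ⟨h1, h2⟩ := Double.mk_eq_iff.1 h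
      simp only at h1 h2
      subst h1
      exact ⟨hx, (h2.resolve_right (disjoint_left.1 hOA hx)).symm⟩
    · rintro ⟨hy, rfl : j = i⟩
      exact ⟨y, hy, rfl⟩
  rw [this]
  exact hO.prod (isOpen_discrete _)

theorem Double.isClosed_doubleSet (hF : IsClosed F) : IsClosed (doubleSet A F) := by
  rw [← (Double.isQuotientMap_mk A).isClosed_preimage]
  have : Double.mk A ⁻¹' doubleSet A F = Prod.fst ⁻¹' F := by
    ext p
    exact Double.mk_mem_doubleSet
  rw [this]
  exact hF.preimage continuous_fst

/-- The two hypotheses on `c` say that `B` is the full preimage of `A`. Hence no new points are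
identified, and the saturation of an image is the image of a saturated open set under an open map.
-/
theorem Double.isOpenEmbedding_map [TopologicalSpace M] (hc : IsOpenEmbedding c)
    (h : MapsTo c B A) (h' : ∀ m, c m ∈ A → m ∈ B) : IsOpenEmbedding (Double.map c h) := by
  refine IsOpenEmbedding.of_continuous_injective_isOpenMap ?_ ?_ ?_
  · refine (Double.isQuotientMap_mk B).continuous_iff.2 ?_
    change Continuous fun p : M × Bool => Double.mk A (c p.1, p.2)
    have := hc.continuous
    exact (Double.isQuotientMap_mk A).continuous.comp (by fun_prop)
  · intro x y hxy
    obtain ⟨p, rfl⟩ := Double.mk_surjective B x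
    obtain ⟨q, rfl⟩ := Double.mk_surjective B y
    obtain ⟨h1, h2⟩ := Double.mk_eq_iff (p := (c p.1, p.2)) (q := (c q.1, q.2)).1 hxy
    exact Double.mk_eq_iff.2 ⟨hc.injective h1, h2.imp id (h' _)⟩
  · intro O hO
    rw [← (Double.isQuotientMap_mk A).isOpen_preimage]
    have : Double.mk A ⁻¹' (Double.map c h '' O) =
        (fun p : M × Bool => (c p.1, p.2)) '' (Double.mk B ⁻¹' O) := by
      ext ⟨x, i⟩
      constructor
      · rintro ⟨z, hz, hzx⟩
        obtain ⟨⟨m, j⟩, rfl⟩ := Double.mk_surjective B z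
        obtain ⟨h1, h2⟩ := Double.mk_eq_iff (p := (c m, j)) (q := (x, i)).1 hzx
        refine ⟨(m, i), ?_, Prod.ext h1 rfl⟩
        have : Double.mk B (m, i) = Double.mk B (m, j) :=
          Double.mk_eq_iff.2 ⟨rfl, h2.elim (fun h => Or.inl h.symm) fun h => Or.inr (h' _ h)⟩
        rw [mem_preimage, this]
        exact hz
      · rintro ⟨p, hp, hpx⟩
        exact ⟨Double.mk B p, hp, congrArg (Double.mk A) hpx⟩
    rw [this]
    exact (hc.prodMap IsOpenEmbedding.id).isOpenMap _
      (hO.preimage (Double.isQuotientMap_mk B).continuous)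

end Double

/-- The half-open collar `S³ × [0, 1)`. -/
abbrev SphereCollar : Type := S3 × Ico (0 : ℝ) 1

/-- The end `S³ × 0` of the collar. -/
def SphereCollar.base : Set SphereCollar := {z | (z.2 : ℝ) = 0}

theorem S3_nonempty : Nonempty S3 := simplyConnectedSpace_S3.1.elim fun e =>
  ⟨(e.inverse.obj ⟨()⟩).as⟩

theorem SphereCollar.isCompact_le {δ : ℝ} (hδ : δ < 1) :
    IsCompact {z : SphereCollar | (z.2 : ℝ) ≤ δ} := by
  have h1 : IsCompact {u : Ico (0 : ℝ) 1 | (u : ℝ) ≤ δ} := by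
    rw [Subtype.isCompact_iff]
    have : ((↑) '' {u : Ico (0 : ℝ) 1 | (u : ℝ) ≤ δ} : Set ℝ) = Icc 0 δ := by
      ext u
      constructor
      · rintro ⟨u, hu, rfl⟩
        exact ⟨u.2.1, hu⟩
      · intro hu
        exact ⟨⟨u, hu.1, hu.2.trans_lt hδ⟩, hu.2, rfl⟩
    rw [this]
    exact isCompact_Icc
  have h2 := (isCompact_univ (X := S3)).prod h1
  convert h2 using 1
  ext z
  simp

/-! ### Simply connected caps and comparison of doubled complements -/

section Slide

variable {X : Type*} [TopologicalSpace X] [T2Space X] {c : SphereCollar → X}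

/-- Slide the collar `S³ × [0, 1)` inwards until the height is at least `τ * μ`. -/
def slide (μ : ℝ) (hμ : μ < 1) (z : SphereCollar × I) : SphereCollar × I :=
  ((z.1.1, ⟨max (z.1.2 : ℝ) (z.2 * μ), le_max_of_le_left z.1.2.2.1,
    max_lt z.1.2.2.2 (by
      rcases le_total μ 0 with h | h
      · exact (mul_nonpos_of_nonneg_of_nonpos z.2.2.1 h).trans_lt one_pos
      · exact (mul_le_of_le_one_left h z.2.2.2).trans_lt hμ)⟩), z.2)

/-- Removing a closed collar does not affect simple connectedness. -/
theorem isSimplyConnected_compl_collar [SimplyConnectedSpace X] (hc : IsOpenEmbedding c) {δ : ℝ}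
    (hδ : δ < 1) : IsSimplyConnected (c '' {z | (z.2 : ℝ) ≤ δ})ᶜ := by
  have := S3_nonempty
  have : Nonempty SphereCollar := ⟨(Classical.arbitrary _, ⟨0, by norm_num⟩)⟩
  -- Sliding up to a height `μ > δ` ends inside the complement of the collar. Since `μ < 1`, points
  -- above `μ` stay fixed and the slide extends by the identity.
  obtain ⟨μ, hδμ, hμ⟩ := exists_between hδ
  let E : OpenPartialHomeomorph (X × I) (SphereCollar × I) :=
    (hc.toOpenPartialHomeomorph c).symm.prod (OpenPartialHomeomorph.refl I)
  have hsrc : ∀ p : X × I, p ∈ E.source ↔ p.1 ∈ range c := fun p => by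
    simp [E]
  let H : X × I → X × I := extendById E (slide μ hμ)
  have hHc : ∀ z τ, H (c z, τ) = (c (slide μ hμ (z, τ)).1, τ) := by
    intro z τ
    have h1 : (c z, τ) ∈ E.source := (hsrc _).2 ⟨z, rfl⟩
    have h2 : E (c z, τ) = (z, τ) := Prod.ext
      ((hc.toOpenPartialHomeomorph c).left_inv (mem_univ z)) rfl
    change extendById E _ _ = _
    rw [extendById, if_pos h1, h2]
    rfl
  have hHn : ∀ x τ, x ∉ range c → H (x, τ) = (x, τ) := by
    intro x τ hx
    exact if_neg fun h => hx ((hsrc _).1 h)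
  have hH : Continuous H := by
    have hK : IsClosed (c '' {z | (z.2 : ℝ) ≤ μ}) :=
      ((SphereCollar.isCompact_le hμ).image hc.continuous).isClosed
    refine continuous_extendById E ?_ (C := (c '' {z | (z.2 : ℝ) ≤ μ}) ×ˢ univ)
      (hK.prod isClosed_univ) ?_ ?_ ?_
    · unfold slide
      fun_prop
    · rintro p ⟨⟨z, -, hz⟩, -⟩
      exact (hsrc _).2 ⟨z, hz⟩
    · intro p _
      simp [E]
    · rintro ⟨x, τ⟩ hx hxC
      obtain ⟨z, rfl⟩ := (hsrc _).1 hx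
      have h2 : E (c z, τ) = (z, τ) := Prod.ext
        ((hc.toOpenPartialHomeomorph c).left_inv (mem_univ z)) rfl
      have h3 : μ < z.2 := not_le.1 fun h => hxC ⟨⟨z, h, rfl⟩, trivial⟩
      rw [h2]
      refine Prod.ext (Prod.ext rfl (Subtype.ext (max_eq_left ?_))) rfl
      rcases le_total μ 0 with h | h
      · exact (mul_nonpos_of_nonneg_of_nonpos τ.2.1 h).trans z.2.2.1
      · exact (mul_le_of_le_one_left h τ.2.2).trans h3.le
  set V : Set X := (c '' {z | (z.2 : ℝ) ≤ δ})ᶜ with hV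
  have hcV : ∀ z, c z ∈ V ↔ δ < z.2 := by
    intro z
    rw [hV, mem_compl_iff, hc.injective.mem_set_image, mem_ofPred_eq, not_le]
  have hnV : ∀ x, x ∉ range c → x ∈ V := by
    rintro x hx ⟨z, -, hz⟩
    exact hx ⟨z, hz⟩
  have H0 : ∀ x, (H (x, 0)).1 = x := by
    intro x
    by_cases hx : x ∈ range c
    · obtain ⟨z, rfl⟩ := hx
      rw [hHc]
      change c _ = c z
      congr 1
      refine Prod.ext rfl (Subtype.ext ?_)
      change max (z.2 : ℝ) ((0 : ℝ) * μ) = z.2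
      rw [zero_mul, max_eq_left z.2.2.1]
    · rw [hHn x 0 hx]
  have H1 : ∀ x, (H (x, 1)).1 ∈ V := by
    intro x
    by_cases hx : x ∈ range c
    · obtain ⟨z, rfl⟩ := hx
      rw [hHc, hcV]
      change δ < max (z.2 : ℝ) ((1 : ℝ) * μ)
      rw [one_mul]
      exact hδμ.trans_le (le_max_right _ _)
    · rw [hHn x 1 hx]
      exact hnV x hx
  have HV : ∀ x ∈ V, ∀ τ, (H (x, τ)).1 ∈ V := by
    intro x hxV τ
    by_cases hx : x ∈ range c
    · obtain ⟨z, rfl⟩ := hx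
      rw [hHc, hcV]
      exact ((hcV z).1 hxV).trans_le (le_max_left _ _)
    · rw [hHn x τ hx]
      exact hxV
  -- The slide preserves `V` at all times, so it provides both homotopies showing that the inclusion
  -- of `V` is a homotopy equivalence.
  have e : ContinuousMap.HomotopyEquiv V X :=
    { toFun := ⟨Subtype.val, continuous_subtype_val⟩
      invFun := ⟨fun x => ⟨(H (x, 1)).1, H1 x⟩, by fun_prop⟩
      left_inv := ContinuousMap.Homotopic.symm ⟨
        { toFun := fun p => ⟨(H (p.2, p.1)).1, HV p.2 p.2.2 p.1⟩
          continuous_toFun := by fun_prop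
          map_zero_left := fun x => Subtype.ext (H0 x)
          map_one_left := fun x => rfl }⟩
      right_inv := ContinuousMap.Homotopic.symm ⟨
        { toFun := fun p => (H (p.2, p.1)).1
          continuous_toFun := by fun_prop
          map_zero_left := fun x => H0 x
          map_one_left := fun x => rfl }⟩ }
  exact e.simplyConnectedSpace

theorem isSimplyConnected_collar_gt {δ : ℝ} (hδ0 : 0 ≤ δ) (hδ : δ < 1) :
    IsSimplyConnected {z : SphereCollar | δ < (z.2 : ℝ)} := by
  have := simplyConnectedSpace_S3
  have hconv : ContractibleSpace (Ioo δ 1) :=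
    (convex_Ioo δ 1).contractibleSpace (nonempty_Ioo.2 hδ)
  let e : {z : SphereCollar | δ < (z.2 : ℝ)} ≃ₜ S3 × Ioo δ 1 :=
    { toFun := fun z => (z.1.1, ⟨z.1.2, z.2, z.1.2.2.2⟩)
      invFun := fun z => ⟨(z.1, ⟨z.2, hδ0.trans z.2.2.1.le, z.2.2.2⟩), z.2.2.1⟩
      left_inv := fun z => rfl
      right_inv := fun z => rfl
      continuous_toFun := by fun_prop
      continuous_invFun := by fun_prop }
  have e2 : ContinuousMap.HomotopyEquiv (S3 × Ioo δ 1) (S3 × Unit) :=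
    (ContinuousMap.HomotopyEquiv.refl S3).prodCongr (ContractibleSpace.hequiv _ Unit).some
  have e3 : S3 × Unit ≃ₜ S3 := Homeomorph.prodPUnit S3
  exact (e.toHomotopyEquiv.trans (e2.trans e3.toHomotopyEquiv)).simplyConnectedSpace

/-- The fundamental group of the complement of the double of a subset of the collar
does not depend on the simply connected space that the collar is part of, as far as being infinite
cyclic is concerned. -/
theorem hasInfiniteCyclicPi1_compl_doubleSet_iff [SimplyConnectedSpace X] (hc : IsOpenEmbedding c)
    {F : Set SphereCollar} (hF : IsCompact F) :
    HasInfiniteCyclicPi1 ↥(doubleSet SphereCollar.base F)ᶜ ↔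
      HasInfiniteCyclicPi1 ↥(doubleSet (c '' SphereCollar.base) (c '' F))ᶜ := by
  obtain ⟨δ, hδ0, hδ, hFδ⟩ : ∃ δ : ℝ, 0 ≤ δ ∧ δ < 1 ∧ ∀ z ∈ F, (z.2 : ℝ) ≤ δ := by
    rcases F.eq_empty_or_nonempty with rfl | hne
    · exact ⟨0, le_rfl, one_pos, by simp⟩
    · obtain ⟨z, -, hz⟩ := hF.exists_isMaxOn hne
        (f := fun z : SphereCollar => (z.2 : ℝ)) (by fun_prop)
      exact ⟨z.2, z.2.2.1, z.2.2.2, fun w hw => hz hw⟩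
  set A := c '' SphereCollar.base with hA
  have h : MapsTo c SphereCollar.base A := mapsTo_image _ _
  have h' : ∀ m, c m ∈ A → m ∈ SphereCollar.base := fun m => hc.injective.mem_set_image.1
  have hmap := Double.isOpenEmbedding_map hc h h'
  set V : Set X := (c '' {z | (z.2 : ℝ) ≤ δ})ᶜ with hV
  have hcV : ∀ z, c z ∈ V ↔ δ < z.2 := by
    intro z
    rw [hV, mem_compl_iff, hc.injective.mem_set_image, mem_ofPred_eq, not_le]
  have hVo : IsOpen V :=
    ((SphereCollar.isCompact_le hδ).image hc.continuous).isClosed.isOpen_compl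
  have hVA : Disjoint V A := by
    rw [disjoint_right]
    rintro _ ⟨z, hz, rfl⟩ hzV
    have h1 := (hcV z).1 hzV
    rw [show (z.2 : ℝ) = 0 from hz] at h1
    exact absurd h1 hδ0.not_gt
  let ι : Bool → X → Double A := fun i x => Double.mk A (x, i)
  have hι : ∀ i, IsEmbedding (ι i) := Double.isEmbedding_mk A
  have hιV : ∀ i, IsOpen (ι i '' V) := Double.isOpen_image_mk hVo hVA
  have hιVs : ∀ i, IsSimplyConnected (ι i '' V) := fun i =>
    (hι i).isSimplyConnected_image.2 (isSimplyConnected_compl_collar hc hδ)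
  have memι : ∀ i (p : X × Bool), Double.mk A p ∈ ι i '' V ↔ p.1 ∈ V ∧ p.2 = i := by
    intro i p
    constructor
    · rintro ⟨x, hx, hxp⟩
      obtain ⟨h1, h2⟩ := Double.mk_eq_iff.1 hxp
      simp only at h1 h2
      subst h1
      exact ⟨hx, (h2.resolve_right (disjoint_left.1 hVA hx)).symm⟩
    · rintro ⟨hx, rfl⟩
      exact ⟨p.1, hx, rfl⟩
  set U := Double.map c h '' (doubleSet SphereCollar.base F)ᶜ with hU
  have hUo : IsOpen U := hmap.isOpenMap _ (Double.isClosed_doubleSet hF.isClosed).isOpen_compl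
  -- Above height `δ` the set `F` is absent, so a cap meets the doubled collar in one full copy of
  -- `S³ × (δ, 1)`.
  have hUι : ∀ i, U ∩ ι i '' V = ι i '' (c '' {z | δ < (z.2 : ℝ)}) := by
    intro i
    ext z
    obtain ⟨p, rfl⟩ := Double.mk_surjective A z
    rw [mem_inter_iff, memι, Double.mk_mem_image_map]
    constructor
    · rintro ⟨⟨m, hm, hmp⟩, hpV, rfl⟩
      rw [← hmp, hcV] at hpV
      exact ⟨p.1, ⟨m, hpV, hmp⟩, rfl⟩
    · rintro ⟨x, ⟨m, hm, rfl⟩, hxp⟩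
      have h1 := (memι i p).1 (hxp ▸ ⟨c m, (hcV m).2 hm, rfl⟩)
      refine ⟨⟨m, fun hmF => (hFδ m hmF).not_gt hm, (Double.mk_eq_iff.1 hxp).1⟩, h1⟩
  have hIs : ∀ i, IsSimplyConnected (U ∩ ι i '' V) := by
    intro i
    rw [hUι, (hι i).isSimplyConnected_image, hc.isEmbedding.isSimplyConnected_image]
    exact isSimplyConnected_collar_gt hδ0 hδ
  -- The caps are attached one after the other. They are disjoint because `V` misses the gluing set
  -- `A`, so the first does not affect the overlap with the second.
  have hIs' : IsSimplyConnected ((U ∪ ι false '' V) ∩ ι true '' V) := by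
    have hd : ι false '' V ∩ ι true '' V = ∅ := by
      refine eq_empty_of_forall_notMem fun z hz => ?_
      obtain ⟨p, rfl⟩ := Double.mk_surjective A z
      have h1 := ((memι _ _).1 hz.1).2
      rw [((memι _ _).1 hz.2).2] at h1
      exact absurd h1 (by simp)
    rw [union_inter_distrib_right, hd, union_empty]
    exact hIs true
  have htotal : (U ∪ ι false '' V) ∪ ι true '' V = (doubleSet A (c '' F))ᶜ := by
    ext z
    obtain ⟨p, rfl⟩ := Double.mk_surjective A z
    rw [mem_union, mem_union, memι, memι, Double.mk_mem_image_map,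
      mem_compl_iff (doubleSet A (c '' F)), Double.mk_mem_doubleSet]
    constructor
    · rintro ((⟨m, hm, hmp⟩ | ⟨hp, -⟩) | ⟨hp, -⟩)
      · rw [← hmp, hc.injective.mem_set_image]
        exact hm
      all_goals
        rintro ⟨m, hm, hmp⟩
        exact hp ⟨m, hFδ m hm, hmp⟩
    · intro hp
      by_cases hpV : p.1 ∈ V
      · cases hp2 : p.2
        · exact Or.inl (Or.inr ⟨hpV, rfl⟩)
        · exact Or.inr ⟨hpV, rfl⟩
      · obtain ⟨m, -, hm⟩ := not_not.1 hpV
        exact Or.inl (Or.inl ⟨m, fun hmF => hp ⟨m, hmF, hm⟩, hm⟩)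
  rw [hasInfiniteCyclicPi1_congr (hmap.isEmbedding.homeomorphImage _), ← hU, ← htotal,
    hasInfiniteCyclicPi1_union_iff hUo (hιV false) (hιVs false) (hIs false),
    hasInfiniteCyclicPi1_union_iff (hUo.union (hιV false)) (hιV true) (hιVs true) hIs']

end Slide

end Superslice

/-! ### Collars of the punctured ball, transport of surfaces, and the conclusion -/

namespace Superslice

open Topology

/-- Beyond radius `3 * g + 2` the first factor is negative and the others are positive, which is
incompatible with a square. This bounds `x` and `y`, and continuity of the right-hand side then
bounds `z`. -/
theorem isCompact_modelSurface (g : ℕ) : IsCompact (modelSurface g) := by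
  let P : ℝ × ℝ → ℝ := fun w => ((3 * (g : ℝ) + 2) ^ 2 - w.1 ^ 2 - w.2 ^ 2) *
    ∏ i ∈ Finset.Icc 1 g, ((w.1 + 3 * (i : ℝ)) ^ 2 + w.2 ^ 2 - 1)
  have hP : Continuous P := by fun_prop
  set R : ℝ := 3 * (g : ℝ) + 2 with hR
  have hR0 : 0 < R := by positivity
  have hK : IsCompact (Icc (-R) R ×ˢ Icc (-R) R) := isCompact_Icc.prod isCompact_Icc
  obtain ⟨C, hC⟩ := hK.bddAbove_image hP.continuousOn
  have hbig : IsCompact (Icc (-R) R ×ˢ (Icc (-R) R ×ˢ Icc (-(C + 1)) (C + 1))) :=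
    isCompact_Icc.prod (isCompact_Icc.prod isCompact_Icc)
  refine hbig.of_isClosed_subset ?_ ?_
  · have h1 : IsClosed {v : ℝ × ℝ × ℝ | v.1 ≤ 0} := isClosed_le (by fun_prop) (by fun_prop)
    have h2 : IsClosed {v : ℝ × ℝ × ℝ | v.2.2 ^ 2 = P (v.1, v.2.1)} :=
      isClosed_eq (by fun_prop) (by fun_prop)
    exact h1.inter h2
  · rintro ⟨x, y, z⟩ ⟨-, hz⟩
    change z ^ 2 = P (x, y) at hz
    have hxy : x ^ 2 + y ^ 2 ≤ R ^ 2 := by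
      by_contra hlt
      push Not at hlt
      have hneg : P (x, y) < 0 := by
        refine mul_neg_of_neg_of_pos (by simp only; linarith) (Finset.prod_pos fun i hi => ?_)
        have hig : (i : ℝ) ≤ g := by exact_mod_cast (Finset.mem_Icc.1 hi).2
        have hi0 : (0 : ℝ) ≤ i := by positivity
        set ρ := √(x ^ 2 + y ^ 2) with hρ
        have hρ2 : ρ ^ 2 = x ^ 2 + y ^ 2 := Real.sq_sqrt (by positivity)
        have hRρ : R < ρ := by
          rw [hρ]
          exact Real.lt_sqrt_of_sq_lt hlt
        have hxρ : -ρ ≤ x := (abs_le.1 (Real.abs_le_sqrt (by nlinarith : x ^ 2 ≤ x ^ 2 + y ^ 2))).1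
        -- Positivity rests on `(x + 3i)² + y² = (ρ - 3i)² + 6i(x + ρ) ≥ 4`.
        have h3 : 2 ≤ ρ - 3 * i := by linarith
        have h4 : 0 ≤ 6 * (i : ℝ) * (x + ρ) := by
          have : 0 ≤ x + ρ := by linarith
          positivity
        simp only
        nlinarith
      linarith [sq_nonneg z]
    have hx : x ∈ Icc (-R) R := abs_le.1 (abs_le_of_sq_le_sq (by nlinarith) hR0.le)
    have hy : y ∈ Icc (-R) R := abs_le.1 (abs_le_of_sq_le_sq (by nlinarith) hR0.le)
    have hzC : z ^ 2 ≤ C := hz ▸ hC ⟨(x, y), ⟨hx, hy⟩, rfl⟩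
    exact ⟨hx, hy, by constructor <;> nlinarith [sq_nonneg (z + 1), sq_nonneg (z - 1)]⟩

section BallCollar

/-- The segment from a point `s` of the sphere to `p`. -/
def coneMap (p : EuclideanSpace ℝ (Fin 4)) (s : S3) (t : ℝ) : EuclideanSpace ℝ (Fin 4) :=
  (1 - t) • (s : EuclideanSpace ℝ (Fin 4)) + t • p

variable {p : EuclideanSpace ℝ (Fin 4)}

theorem coneMap_mem (hp : ‖p‖ < 1) (s : S3) {t : ℝ} (ht : t ∈ Icc (0 : ℝ) 1) :
    coneMap p s t ∈ Metric.closedBall (0 : EuclideanSpace ℝ (Fin 4)) 1 :=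
  convex_closedBall 0 1 (Metric.sphere_subset_closedBall s.2)
    (mem_closedBall_zero_iff.2 hp.le) (by linarith [ht.2]) ht.1 (by ring)

/-- If `t < t'`, then `(1 - t) s = (1 - t') s' + (t' - t) p`, and comparing norms gives `1 - t ≤ (1
- t') + (t' - t) ‖p‖ < 1 - t`. -/
theorem coneMap_height_le (hp : ‖p‖ < 1) {s s' : S3} {t t' : ℝ} (ht' : t' ≤ 1)
    (h : coneMap p s t = coneMap p s' t') : t' ≤ t := by
  by_contra hlt
  push Not at hlt
  have h1 : (1 - t) • (s : EuclideanSpace ℝ (Fin 4)) = (1 - t') • (s' : _) + (t' - t) • p := by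
    unfold coneMap at h
    rw [sub_smul t' t p, ← add_sub_assoc, ← h, add_sub_cancel_right]
  have h2 := congrArg norm h1
  rw [norm_smul, norm_eq_of_mem_sphere, Real.norm_eq_abs, abs_of_pos (by linarith)] at h2
  have h3 := norm_add_le ((1 - t') • (s' : EuclideanSpace ℝ (Fin 4))) ((t' - t) • p)
  rw [norm_smul, norm_smul, norm_eq_of_mem_sphere, Real.norm_eq_abs, Real.norm_eq_abs,
    abs_of_nonneg (by linarith), abs_of_pos (by linarith)] at h3
  nlinarith

theorem coneMap_inj (hp : ‖p‖ < 1) {s s' : S3} {t t' : ℝ} (ht : t < 1) (ht' : t' ≤ 1)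
    (h : coneMap p s t = coneMap p s' t') : s = s' ∧ t = t' := by
  obtain rfl : t = t' := le_antisymm (coneMap_height_le hp ht.le h.symm)
    (coneMap_height_le hp ht' h)
  refine ⟨Subtype.ext ?_, rfl⟩
  unfold coneMap at h
  exact smul_right_injective _ (by linarith : 1 - t ≠ 0) (add_right_cancel h)

/-- The ray from `p` through `x` meets the sphere at some `p + r • (x - p)` with `r ≥ 1`, by the
intermediate value theorem: at `r = 2 / ‖x - p‖` the norm is at least `2 - ‖p‖`. The height of `x`
is `1 - r⁻¹`. -/
theorem exists_coneMap_eq (hp : ‖p‖ < 1) {x : EuclideanSpace ℝ (Fin 4)} (hx : ‖x‖ ≤ 1)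
    (hxp : x ≠ p) : ∃ s : S3, ∃ t ∈ Ico (0 : ℝ) 1, coneMap p s t = x := by
  have hpos : 0 < ‖x - p‖ := norm_pos_iff.2 (sub_ne_zero.2 hxp)
  have hle : ‖x - p‖ ≤ 2 := (norm_sub_le x p).trans (by linarith)
  have h1R : 1 ≤ 2 / ‖x - p‖ := (one_le_div hpos).2 hle
  have hc : Continuous fun r : ℝ => ‖p + r • (x - p)‖ := by fun_prop
  obtain ⟨r, hr, hr1⟩ := intermediate_value_Icc h1R hc.continuousOn
    (show (1 : ℝ) ∈ Icc _ _ by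
      refine ⟨by simpa using hx, ?_⟩
      have h1 := norm_sub_norm_le ((2 / ‖x - p‖) • (x - p)) (-p)
      rw [sub_neg_eq_add, norm_neg, norm_smul, Real.norm_eq_abs, abs_of_pos (by positivity),
        div_mul_cancel₀ _ hpos.ne', add_comm] at h1
      linarith)
  have hr0 : 0 < r := one_pos.trans_le hr.1
  refine ⟨⟨p + r • (x - p), mem_sphere_zero_iff_norm.2 hr1⟩, 1 - r⁻¹, ⟨?_, ?_⟩, ?_⟩
  · have := inv_le_one_of_one_le₀ hr.1
    linarith
  · have := inv_pos.2 hr0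
    linarith
  · unfold coneMap
    simp only
    rw [sub_sub_cancel, smul_add, smul_smul, inv_mul_cancel₀ hr0.ne', one_smul, sub_smul, one_smul]
    abel

/-- The collar of the boundary of the ball obtained by coning off the sphere to `p`. -/
def ballCollar (hp : ‖p‖ < 1) (z : SphereCollar) : D4 :=
  ⟨coneMap p z.1 z.2, coneMap_mem hp z.1 ⟨z.2.2.1, z.2.2.2.le⟩⟩

theorem range_ballCollar (hp : ‖p‖ < 1) : range (ballCollar hp) = {x : D4 | (x : EuclideanSpace ℝ (Fin 4)) ≠ p} := by
  ext x
  constructor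
  · rintro ⟨z, rfl⟩ h
    have h1 : coneMap p z.1 z.2 = coneMap p z.1 1 := by
      refine Eq.trans h ?_
      simp [coneMap]
    exact z.2.2.2.ne (coneMap_inj hp z.2.2.2 le_rfl h1).2
  · intro hx
    obtain ⟨s, t, ht, h⟩ := exists_coneMap_eq hp (mem_closedBall_zero_iff.1 x.2) hx
    exact ⟨(s, ⟨t, ht⟩), Subtype.ext h⟩

/-- Openness comes from compactness of the closed cone `S³ × [0, 1]`. It maps onto the ball and is
injective below height `1`, so the image of an open set of the collar is the complement of a compact
image. -/
theorem isOpenEmbedding_ballCollar (hp : ‖p‖ < 1) : IsOpenEmbedding (ballCollar hp) := by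
  have hc : Continuous (ballCollar hp) := by
    unfold ballCollar coneMap
    fun_prop
  refine IsOpenEmbedding.of_continuous_injective_isOpenMap hc ?_ ?_
  · intro z w h
    have h1 := coneMap_inj hp z.2.2.2 w.2.2.2.le (congrArg Subtype.val h)
    exact Prod.ext h1.1 (Subtype.ext h1.2)
  · intro O hO
    let q : S3 × Icc (0 : ℝ) 1 → D4 := fun z => ⟨coneMap p z.1 z.2, coneMap_mem hp z.1 z.2.2⟩
    have hq : Continuous q := by
      unfold q coneMap
      fun_prop
    let i : SphereCollar → S3 × Icc (0 : ℝ) 1 := fun z => (z.1, ⟨z.2, z.2.2.1, z.2.2.2.le⟩)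
    have hi : IsOpenEmbedding i := by
      refine IsOpenEmbedding.prodMap IsOpenEmbedding.id
        (g := fun u : Ico (0 : ℝ) 1 => (⟨u, u.2.1, u.2.2.le⟩ : Icc (0 : ℝ) 1)) ⟨?_, ?_⟩
      · exact IsEmbedding.of_comp (by fun_prop) continuous_subtype_val IsEmbedding.subtypeVal
      · have : range (fun u : Ico (0 : ℝ) 1 => (⟨u, u.2.1, u.2.2.le⟩ : Icc (0 : ℝ) 1)) =
            {u : Icc (0 : ℝ) 1 | (u : ℝ) < 1} := by
          ext u
          constructor
          · rintro ⟨v, rfl⟩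
            exact v.2.2
          · exact fun hu => ⟨⟨u, u.2.1, hu⟩, rfl⟩
        rw [this]
        exact isOpen_lt (by fun_prop) (by fun_prop)
    have hcl : IsClosed (q '' (i '' O)ᶜ) :=
      ((hi.isOpenMap O hO).isClosed_compl.isCompact.image hq).isClosed
    have heq : ballCollar hp '' O = (q '' (i '' O)ᶜ)ᶜ := by
      ext x
      constructor
      · rintro ⟨z, hz, rfl⟩ ⟨w, hw, hwz⟩
        have h1 := coneMap_inj hp z.2.2.2 w.2.2.2 (congrArg Subtype.val hwz.symm)
        exact hw ⟨z, hz, Prod.ext h1.1 (Subtype.ext h1.2)⟩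
      · intro hx
        have hxq : ∃ w, q w = x := by
          by_cases hxp : (x : EuclideanSpace ℝ (Fin 4)) = p
          · obtain ⟨s⟩ := S3_nonempty
            exact ⟨(s, ⟨1, by norm_num⟩), Subtype.ext (by simp [q, coneMap, hxp])⟩
          · obtain ⟨s, t, ht, h⟩ := exists_coneMap_eq hp (mem_closedBall_zero_iff.1 x.2) hxp
            exact ⟨(s, ⟨t, ht.1, ht.2.le⟩), Subtype.ext h⟩
        obtain ⟨w, rfl⟩ := hxq
        by_contra hn
        refine hx ⟨w, ?_, rfl⟩
        rintro ⟨z, hz, rfl⟩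
        exact hn ⟨z, hz, rfl⟩
    rw [heq]
    exact hcl.isOpen_compl

end BallCollar

/-- A proper surface contained in an open set can be transported to another manifold along
an open embedding of that open set. -/
theorem IsProperSurface.transport {X Y M : Type*} [TopologicalSpace X] [TopologicalSpace Y]
    [TopologicalSpace M] {b : S3 → X} {b' : S3 → Y} {j : S3 → M} {c : M → X} {c' : M → Y}
    (hc : IsOpenEmbedding c) (hc' : IsOpenEmbedding c') (hb : ∀ s, c (j s) = b s)
    (hb' : ∀ s, c' (j s) = b' s) {K : Set S3} {g : ℕ} {G : Set M}
    (h : IsProperSurface b K g (c '' G)) : IsProperSurface b' K g (c' '' G) := by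
  obtain rfl : c ∘ j = b := funext hb
  obtain rfl : c' ∘ j = b' := funext hb'
  have : Nonempty M := S3_nonempty.map j
  refine ⟨?_, ?_, ?_⟩
  · obtain ⟨f, hf, hfr, hfb⟩ := h.param
    have hlift : ∀ v, ∃ m, c m = f v := fun v => by
      have h1 : f v ∈ c '' G := hfr ▸ mem_range_self v
      exact h1.imp fun m hm => hm.2
    choose f₀ hf₀ using hlift
    obtain rfl : c ∘ f₀ = f := funext hf₀
    have hinj := hc.injective.image_injective
    rw [range_comp] at hfr
    rw [image_comp, image_comp] at hfb
    refine ⟨c' ∘ f₀, hc'.isEmbedding.comp ((hc.isEmbedding.of_comp_iff).1 hf), ?_, ?_⟩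
    · rw [range_comp, hinj hfr]
    · rw [image_comp, image_comp, hinj hfb]
  · have h1 := h.inter_boundary
    rw [range_comp, ← image_inter hc.injective, image_comp] at h1
    rw [range_comp, ← image_inter hc'.injective, image_comp, hc.injective.image_injective h1]
  · rintro _ ⟨m, hm, rfl⟩
    obtain ⟨e, he, hloc⟩ := h.locallyFlat (c m) ⟨m, hm, rfl⟩
    let E := hc.toOpenPartialHomeomorph c
    let E' := hc'.toOpenPartialHomeomorph c'
    have hE' : ∀ m, E'.symm (c' m) = m := fun m => E'.left_inv (mem_univ m)
    have hval : ∀ m, (E'.symm.trans (E.trans e)) (c' m) = e (c m) := by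
      intro m
      change e (c (E'.symm (c' m))) = _
      rw [hE']
    have hsrc : ∀ y, y ∈ (E'.symm.trans (E.trans e)).source ↔ ∃ m, c' m = y ∧ c m ∈ e.source := by
      intro y
      simp only [OpenPartialHomeomorph.trans_source, mem_inter_iff, mem_preimage]
      constructor
      · rintro ⟨⟨m, -, rfl⟩, -, h2⟩
        change c (E'.symm (c' m)) ∈ e.source at h2
        rw [hE'] at h2
        exact ⟨m, rfl, h2⟩
      · rintro ⟨m, rfl, h2⟩
        refine ⟨⟨m, trivial, rfl⟩, mem_univ _, ?_⟩
        change c (E'.symm (c' m)) ∈ e.source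
        rwa [hE']
    -- The flat chart of the first manifold is precomposed with the partial homeomorphism `c ∘
    -- c'⁻¹`.
    refine ⟨E'.symm.trans (E.trans e), (hsrc _).2 ⟨m, rfl, he⟩, fun y hy => ?_⟩
    obtain ⟨n, rfl, hn⟩ := (hsrc y).1 hy
    rw [hval]
    obtain ⟨h1, h2⟩ := hloc _ hn
    rw [range_comp, hc.injective.mem_set_image] at h1
    rw [hc.injective.mem_set_image] at h2
    rw [range_comp, hc'.injective.mem_set_image, hc'.injective.mem_set_image]
    exact ⟨h1, h2⟩

/-- A closed proper subset of the ball misses a point of the open ball. -/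
theorem exists_norm_lt_one_notMem {F : Set D4} (hF : IsClosed F) (hne : ∃ x, x ∉ F) :
    ∃ x : D4, x ∉ F ∧ ‖(x : EuclideanSpace ℝ (Fin 4))‖ < 1 := by
  obtain ⟨x, hx⟩ := hne
  -- Radial scaling of `x`: factors slightly below `1` stay outside the closed set `F` and reach the
  -- open ball.
  let γ : ℝ → D4 := fun r => ⟨(projIcc (0 : ℝ) 1 zero_le_one r : ℝ) • (x : _), by
    rw [mem_closedBall_zero_iff, norm_smul, Real.norm_eq_abs, abs_of_nonneg (projIcc 0 1 _ r).2.1]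
    exact mul_le_one₀ (projIcc 0 1 _ r).2.2 (norm_nonneg _) (mem_closedBall_zero_iff.1 x.2)⟩
  have hγ : Continuous γ := by
    have : Continuous fun r : ℝ => (projIcc (0 : ℝ) 1 zero_le_one r : ℝ) :=
      continuous_subtype_val.comp continuous_projIcc
    exact (this.smul continuous_const).subtype_mk _
  have h1 : γ 1 = x := Subtype.ext (by simp [γ])
  have h2 : ∀ᶠ r in 𝓝[<] (1 : ℝ), γ r ∉ F :=
    nhdsWithin_le_nhds (hγ.continuousAt.preimage_mem_nhds
      (hF.isOpen_compl.mem_nhds (by rw [h1]; exact hx)))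
  obtain ⟨r, hr, hr1⟩ := (h2.and self_mem_nhdsWithin).exists
  refine ⟨γ r, hr, ?_⟩
  have h3 : (projIcc (0 : ℝ) 1 zero_le_one r : ℝ) < 1 := by
    rw [coe_projIcc]
    exact max_lt one_pos ((min_le_right _ _).trans_lt hr1)
  change ‖(projIcc (0 : ℝ) 1 zero_le_one r : ℝ) • (x : EuclideanSpace ℝ (Fin 4))‖ < 1
  rw [norm_smul, Real.norm_eq_abs, abs_of_nonneg (projIcc 0 1 _ r).2.1]
  exact (mul_le_of_le_one_right (projIcc 0 1 _ r).2.1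
    (mem_closedBall_zero_iff.1 x.2)).trans_lt h3

theorem simplyConnectedSpace_D4 : SimplyConnectedSpace D4 := by
  have : ContractibleSpace D4 := (convex_closedBall 0 1).contractibleSpace ⟨0, by simp⟩
  infer_instance

theorem image_base_eq_range {X : Type*} {b : S3 → X} {c : SphereCollar → X}
    (hb : ∀ s, c (s, ⟨0, by norm_num⟩) = b s) : c '' SphereCollar.base = range b := by
  ext x
  constructor
  · rintro ⟨⟨s, t⟩, ht, rfl⟩
    obtain rfl : t = ⟨0, by norm_num⟩ := Subtype.ext ht
    exact ⟨s, (hb s).symm⟩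
  · rintro ⟨s, rfl⟩
    exact ⟨(s, ⟨0, by norm_num⟩), rfl, hb s⟩

/-- A surface in the ball whose double is a `ℤ`-surface gives one of the same genus in every
simply connected `4`-manifold bounded by the sphere. -/
theorem exists_isZSurface_of_ball {X : Type*} [TopologicalSpace X] [SimplyConnectedSpace X]
    {b : S3 → X} (hX : IsFourManifoldBoundedBy X b) {K : Set S3} {g : ℕ} {F : Set D4}
    (hF : IsProperSurface sphereToBall K g F)
    (hZ : IsZSurface (doubleSet (range sphereToBall) F)) :
    ∃ F' : Set X, IsProperSurface b K g F' ∧ IsZSurface (doubleSet (range b) F') := by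
  have := hX.t2
  have := simplyConnectedSpace_D4
  have hFc : IsCompact F := by
    obtain ⟨f, hf, hfr, -⟩ := hF.param
    have := isCompact_iff_compactSpace.1 (isCompact_modelSurface g)
    exact hfr ▸ isCompact_range hf.continuous
  obtain ⟨p, hpF, hp⟩ := exists_norm_lt_one_notMem hFc.isClosed (by
    obtain ⟨z, hz⟩ := hZ.1.nonempty
    obtain ⟨q, rfl⟩ := Double.mk_surjective _ z
    exact ⟨q.1, fun hq => hz (Double.mk_mem_doubleSet.2 hq)⟩)
  have hc := isOpenEmbedding_ballCollar hp
  have hcb : ∀ s, ballCollar hp (s, ⟨0, by norm_num⟩) = sphereToBall s := fun s =>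
    Subtype.ext (by simp [ballCollar, coneMap, sphereToBall])
  obtain ⟨c, hcX, hcXb⟩ := hX.exists_collar
  have hFr : F ⊆ range (ballCollar hp) := by
    rw [range_ballCollar]
    intro x hx h
    exact hpF (Subtype.ext h ▸ hx)
  obtain ⟨G, rfl⟩ := subset_range_iff_exists_image_eq.1 hFr
  have hG : IsCompact G := hc.isInducing.isCompact_iff.2 hFc
  refine ⟨c '' G, hF.transport (j := fun s => (s, ⟨0, by norm_num⟩)) hc hcX hcb hcXb, ?_⟩
  -- Both doubled complements are compared with that of the same set `G` in the doubled collar.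
  rw [isZSurface_iff, ← image_base_eq_range hcb,
    ← hasInfiniteCyclicPi1_compl_doubleSet_iff hc hG] at hZ
  rw [isZSurface_iff, ← image_base_eq_range hcXb,
    ← hasInfiniteCyclicPi1_compl_doubleSet_iff hcX hG]
  exact hZ

end Superslice

end

theorem mainTheorem12 {X : Type*} [TopologicalSpace X] [SimplyConnectedSpace X]
    (b : Superslice.S3 → X) (hX : Superslice.IsFourManifoldBoundedBy X b)
    (K : Set Superslice.S3) (hK : Superslice.IsKnot K) :
    Superslice.supersliceGenus b K ≤
      Superslice.supersliceGenus Superslice.sphereToBall K := by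
  unfold Superslice.supersliceGenus
  refine biInf_mono ?_
  rintro g ⟨F, hF, hZ⟩
  exact Superslice.exists_isZSurface_of_ball hX hF hZ
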